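/- Let $\mathbb{K}$ be a field of prime characteristic $p$ that is $F$-finite (i.e. $\mathbb{K}$ is a finite extension of its subfield $\mathbb{K}^p$). Let $m,t,n$ be positive integers, let $Y$ and $Z$ be matrices of indeterminates of sizes $m\times t$ and $t\times n$ respectively, and set $S:=\mathbb{K}[Y,Z]$. Let $(YZ)$ be the ideal of $S$ generated by the entries of the product matrix $YZ$, and for a matrix $A$ let $I_k(A)$ be the ideal generated by its size $k$ minors. For non-negative integers $r,s$ with $r+s\le t$, let $$\mathfrak{p}_{r,s}:=I_{r+1}(Y)+I_{s+1}(Z)+(YZ)\subseteq S$$ be the ideal defining the corresponding variety of complexes. (1) If $t\le\min(m,n)$, there is a single splitting $\theta$ of the Frobenius map on $S$ (i.e. an additive map $\theta:S\to S$ with $\theta(a^pb)=a\,\theta(b)$ and $\theta(a^p)=a$ for all $a,b\in S$) that compatibly splits all the varieties of complexes: $\theta(\mathfrak{p}_{r,s})\subseteq\mathfrak{p}_{r,s}$ for all non-negative integers $r,s$ with $r+s\le t$. (2) For any triple $(m,n,t)$, the generic nullcone $R:=S/(YZ)$ is $F$-pure: its Frobenius endomorphism is pure, i.e. for every $R$-module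 $M$ the map $R\otimes_R M\to F_*R\otimes_R M$ induced by Frobenius is injective, where $F_*R$ denotes $R$ regarded as an $R$-module via Frobenius. -/

import Mathlib

universe u v w

/-- A ring homomorphism `f : A → B` is pure if, for every `A`-module `M`, the map
`A ⊗ M → B ⊗ M` induced by `f` is injective; here `B` is an `A`-module through `f`. -/
def RingHomIsPure {A : Type u} {B : Type v} [CommRing A] [CommRing B] (f : A →+* B) : Prop :=
  letI : Algebra A B := f.toAlgebra
  ∀ (M : Type w) [AddCommGroup M] [Module A M],
    Function.Injective ((Algebra.linearMap A B).rTensor M)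

/-- A ring of characteristic `p` is `F`-pure if its Frobenius endomorphism is pure. -/
def IsFPure (p : ℕ) (R : Type u) [CommRing R] [ExpChar R p] : Prop :=
  RingHomIsPure.{u, u, w} (frobenius R p)

/-- A ring of characteristic `p` is `F`-finite if it is a finitely generated module over itself
through its Frobenius endomorphism. -/
def IsFFinite (p : ℕ) (R : Type u) [CommRing R] [ExpChar R p] : Prop :=
  (frobenius R p).Finite

/-- `θ` is a splitting of the Frobenius map `F` of `S`: it is `S`-linear from `S`, viewed as an
`S`-module through `F`, to `S`, and `θ ∘ F = id`. -/
structure IsFrobeniusSplitting (p : ℕ) {S : Type u} [CommRing S] [ExpChar S p]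
    (θ : S →+ S) : Prop where
  map_frobenius_mul : ∀ a b : S, θ (frobenius S p a * b) = a * θ b
  map_frobenius : ∀ a : S, θ (frobenius S p a) = a

/-- The ideal `I` is compatibly split with respect to `θ`: `θ(I) ⊆ I`. -/
def IsCompatiblySplit {S : Type u} [CommRing S] (θ : S →+ S) (I : Ideal S) : Prop :=
  ∀ f ∈ I, θ f ∈ I

/-- The ideal `I_k(A)` generated by the size `k` minors of the matrix `A`. -/
def minorsIdeal {S : Type u} [CommRing S] {a b : ℕ} (k : ℕ) (A : Matrix (Fin a) (Fin b) S) :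
    Ideal S :=
  Ideal.span {d | ∃ (f : Fin k ↪o Fin a) (g : Fin k ↪o Fin b), d = (A.submatrix f g).det}

/-- The ideal generated by the entries of the matrix `A`. -/
def entriesIdeal {S : Type u} [CommRing S] {a b : ℕ} (A : Matrix (Fin a) (Fin b) S) : Ideal S :=
  Ideal.span {c | ∃ i j, c = A i j}

/-- The polynomial ring `K[Y, Z]` in the entries of an `m × t` matrix `Y` and a `t × n`
matrix `Z` of indeterminates. -/
abbrev PolyYZ (K : Type u) [Field K] (m t n : ℕ) : Type u :=
  MvPolynomial ((Fin m × Fin t) ⊕ (Fin t × Fin n)) K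

/-- The generic `m × t` matrix `Y`. -/
noncomputable def matY (K : Type u) [Field K] (m t n : ℕ) :
    Matrix (Fin m) (Fin t) (PolyYZ K m t n) :=
  Matrix.of fun i j => MvPolynomial.X (Sum.inl (i, j))

/-- The generic `t × n` matrix `Z`. -/
noncomputable def matZ (K : Type u) [Field K] (m t n : ℕ) :
    Matrix (Fin t) (Fin n) (PolyYZ K m t n) :=
  Matrix.of fun i j => MvPolynomial.X (Sum.inr (i, j))

/-- The ideal `(YZ)` generated by the entries of the product matrix. -/
noncomputable def nullconeIdeal (K : Type u) [Field K] (m t n : ℕ) : Ideal (PolyYZ K m t n) :=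
  entriesIdeal (matY K m t n * matZ K m t n)

/-- The ideal `𝔭_{r,s} = I_{r+1}(Y) + I_{s+1}(Z) + (YZ)` of a variety of complexes. -/
noncomputable def complexIdeal (K : Type u) [Field K] (m t n r s : ℕ) :
    Ideal (PolyYZ K m t n) :=
  minorsIdeal (r + 1) (matY K m t n) + minorsIdeal (s + 1) (matZ K m t n) + nullconeIdeal K m t n

/-- The generic nullcone `K[Y, Z] / (YZ)`. -/
abbrev GenericNullcone (K : Type u) [Field K] (m t n : ℕ) : Type u :=
  PolyYZ K m t n ⧸ nullconeIdeal K m t n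

theorem nullconeIdeal_ne_top (K : Type u) [Field K] (m t n : ℕ) : nullconeIdeal K m t n ≠ ⊤ := by
  intro h
  have hle : nullconeIdeal K m t n ≤
      RingHom.ker (MvPolynomial.constantCoeff : PolyYZ K m t n →+* K) := by
    rw [nullconeIdeal, entriesIdeal, Ideal.span_le]
    rintro _ ⟨i, j, rfl⟩
    simp [Matrix.mul_apply, matY, matZ, RingHom.mem_ker]
  have h1 : (1 : PolyYZ K m t n) ∈ nullconeIdeal K m t n := by rw [h]; trivial
  simpa [RingHom.mem_ker] using hle h1

instance genericNullcone_nontrivial (K : Type u) [Field K] (m t n : ℕ) :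
    Nontrivial (GenericNullcone K m t n) :=
  Ideal.Quotient.nontrivial_iff.2 (nullconeIdeal_ne_top K m t n)

instance genericNullcone_expChar (K : Type u) [Field K] (p : ℕ) [ExpChar K p] (m t n : ℕ) :
    ExpChar (GenericNullcone K m t n) p :=
  expChar_of_injective_algebraMap (algebraMap K (GenericNullcone K m t n)).injective p

/-! ### Maps linear over Frobenius on a polynomial ring. -/

section FrobeniusTrace

open MvPolynomial

/-! Let `τ` be `frobTrace`. The map `g ↦ τ (f ^ (p - 1) * g)` is linear over Frobenius, and it
splits Frobenius if the leading monomial of `f` is the product of all variables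
(`frobTrace_pow_eq_one`). It preserves an ideal `H` with `h` generators as soon as `f ∈ H ^ h`: then
`f ^ (p - 1) * H` lies in `H ^ (h * (p - 1) + 1)`, hence in the ideal of the `p`-th powers of the
generators. The same works away from `δ = 0` (`isCompatiblySplit_saturationBy`).

The polynomial `f` is `splittingPoly`, a product of minors of `Y`, of `Z` and of `Y * Z`. The
diagonals of the minors of `Y` and `Z` cover the cells on one side of the main diagonals, and the
leading terms of the minors of `Y * Z` cover the other cells, each cell once
(`hasLead_splittingPoly`). Now fix an `r`-minor `δ` of `Y`. Where it is invertible, the locus `Y * Z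
= 0`, `rank Y ≤ r` has `(m - r) * (t - r) + r * n` equations. There `Y` has rank at most `r`, `Z`
has rank at most `t - r`, and a `k`-minor of `Y * Z` vanishes to order `k`; these orders add up to
the number of equations. So the ideal of each stratum is preserved, and likewise for the strata of
`rank Y ≤ r` alone.

It remains to see that `(YZ)` and `I_{r+1}(Y)` are the intersections of the ideals of their strata
(`mem_nullconeIdeal_iff`, `mem_minorsIdeal_iff`). An element of all strata vanishes at every
field-valued point of the locus. Reduce it modulo known leading monomials. If the remainder is
nonzero, its exponents contain no long chains of cells, and this is what is needed to build a point
of the locus over a field of Hahn series at which one monomial of the remainder has strictly least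
valuation (`exists_nullcone_point`, `exists_rank_le_point`): a contradiction.

Transposition gives `I_{s+1}(Z)`, and sums of preserved ideals are preserved. For `F`-purity with
arbitrary sizes, the nullcone is a retract of one with `t ≤ min m n`. -/

theorem exists_frobenius_inverse_linear (K : Type u) [Field K] (p : ℕ) [Fact p.Prime] [CharP K p] :
    ∃ φ : K →+ K, φ 1 = 1 ∧ ∀ a b, φ (a ^ p * b) = a * φ b := by
  let F := (frobenius K p).fieldRange
  -- A linear retraction of `K` onto its subfield of `p`-th powers, followed by the inverse of
  -- Frobenius, gives `φ`.
  obtain ⟨ψ, hψ⟩ := LinearMap.exists_leftInverse_of_injective (Algebra.linearMap F K)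
    (LinearMap.ker_eq_bot.2 (algebraMap F K).injective)
  let e : K ≃+* F := RingEquiv.ofBijective (frobenius K p).rangeRestrictField
    ⟨(frobenius K p).rangeRestrictField.injective,
      (frobenius K p).rangeRestrictField_bijective.2⟩
  have he : ∀ a, (e a : K) = a ^ p := fun a => rfl
  refine ⟨e.symm.toAddMonoidHom.comp ψ.toAddMonoidHom, ?_, fun a b => ?_⟩
  · have : ψ 1 = 1 := by simpa using LinearMap.congr_fun hψ 1
    simp [this]
  · have : ψ (a ^ p * b) = e a * ψ b := by
      rw [← he, ← smul_eq_mul (e a) (ψ b), ← map_smul]; rfl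
    simp [this]

variable {K : Type u} [Field K] {σ : Type v}

theorem injective_pShift [Fintype σ] {p : ℕ} (hp : p ≠ 0) :
    Function.Injective (fun e : σ →₀ ℕ => Finsupp.equivFunOnFinite.symm (fun _ => p - 1) + p • e) := by
  intro e e' h
  ext v
  have := DFunLike.congr_fun h v
  simpa [hp] using this

/-- The generator of the maps `S → S` that are linear over Frobenius, twisted by a map of the
coefficient field. -/
noncomputable def frobTrace [Fintype σ] (p : ℕ) [hp : Fact p.Prime] (φ : K →+ K) :
    MvPolynomial σ K →+ MvPolynomial σ K :=
  (AddMonoidAlgebra.coeffAddEquiv.symm.toAddMonoidHom.comp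
    ((Finsupp.mapRange.addMonoidHom φ).comp
      (Finsupp.comapDomain.addMonoidHom (injective_pShift hp.out.ne_zero)))).comp
    AddMonoidAlgebra.coeffAddEquiv.toAddMonoidHom

variable [Fintype σ] (p : ℕ) [hp : Fact p.Prime] (φ : K →+ K)

theorem coeff_frobTrace (g : MvPolynomial σ K) (e : σ →₀ ℕ) :
    coeff e (frobTrace p φ g) =
      φ (coeff (Finsupp.equivFunOnFinite.symm (fun _ => p - 1) + p • e) g) := rfl

theorem frobTrace_pow_mul [CharP K p] (hφ : ∀ a b, φ (a ^ p * b) = a * φ b)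
    (a b : MvPolynomial σ K) : frobTrace p φ (a ^ p * b) = a * frobTrace p φ b := by
  have : CharP (MvPolynomial σ K) p := inferInstance
  induction a using MvPolynomial.induction_on' with
  | monomial u c =>
    ext e
    rw [coeff_frobTrace, monomial_pow, coeff_monomial_mul', coeff_monomial_mul']
    -- The shift `p - 1` is smaller than `p`, so it does not affect divisibility by the `p`-th power
    -- of a monomial.
    have hiff : p • u ≤ Finsupp.equivFunOnFinite.symm (fun _ : σ => p - 1) + p • e ↔ u ≤ e := by
      rw [Finsupp.le_iff', Finsupp.le_iff' (s := (u.support))]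
      · refine forall₂_congr fun v _ => ?_
        have hp1 := hp.out.one_lt
        simp only [Finsupp.coe_smul, Finsupp.coe_add, Pi.smul_apply, Pi.add_apply, smul_eq_mul,
          Finsupp.coe_equivFunOnFinite_symm]
        constructor
        · intro h
          by_contra! h'
          have : p * (e v + 1) ≤ p * u v := Nat.mul_le_mul_left _ h'
          rw [mul_add] at this
          omega
        · intro h
          have : p * u v ≤ p * e v := Nat.mul_le_mul_left _ h
          omega
      · exact subset_rfl
      · intro v hv
        simp only [Finsupp.mem_support_iff, Finsupp.coe_smul, Pi.smul_apply, smul_eq_mul] at hv ⊢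
        exact fun h => hv (by simp [h])
    by_cases h : u ≤ e
    · rw [if_pos (hiff.2 h), if_pos h, hφ, coeff_frobTrace]
      congr 3
      ext v
      have := h v
      simp only [Finsupp.coe_smul, Finsupp.coe_add, Finsupp.coe_tsub, Pi.smul_apply, Pi.add_apply,
        Pi.sub_apply, smul_eq_mul, Finsupp.coe_equivFunOnFinite_symm, Nat.mul_sub]
      have : p * u v ≤ p * e v := Nat.mul_le_mul_left _ this
      omega
    · rw [if_neg (fun h' => h (hiff.1 h')), if_neg h, map_zero]
  | add a a' ha ha' => rw [add_pow_char, add_mul, map_add, ha, ha', add_mul]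

end FrobeniusTrace

/-! ### Compatibility from order of vanishing. -/

section Saturation

open MvPolynomial

variable {S : Type u} [CommRing S]

/-- The saturation `H : δ^∞`. -/
def Ideal.saturationBy (H : Ideal S) (δ : S) : Ideal S where
  carrier := {g | ∃ N, δ ^ N * g ∈ H}
  zero_mem' := ⟨0, by simp⟩
  add_mem' := by
    rintro a b ⟨N, hN⟩ ⟨M, hM⟩
    refine ⟨N + M, ?_⟩
    have : δ ^ (N + M) * (a + b) = δ ^ M * (δ ^ N * a) + δ ^ N * (δ ^ M * b) := by ring
    rw [this]
    exact H.add_mem (H.mul_mem_left _ hN) (H.mul_mem_left _ hM)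
  smul_mem' := by
    rintro c a ⟨N, hN⟩
    refine ⟨N, ?_⟩
    have : δ ^ N * (c • a) = c * (δ ^ N * a) := by rw [smul_eq_mul]; ring
    rw [this]
    exact H.mul_mem_left _ hN

theorem Ideal.mem_saturationBy {H : Ideal S} {δ g : S} :
    g ∈ H.saturationBy δ ↔ ∃ N, δ ^ N * g ∈ H := Iff.rfl

/-- Pigeonhole: a high enough power of an ideal with few generators lies in the ideal generated by
the `p`-th powers of the generators. -/
theorem mem_span_pow_of_mem_pow_span {ι : Type*} [Fintype ι] (x : ι → S) (p n : ℕ)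
    (hn : Fintype.card ι * (p - 1) < n) {y : S} (hy : y ∈ Ideal.span (Set.range x) ^ n) :
    y ∈ Ideal.span (Set.range fun i => x i ^ p) := by
  obtain ⟨q, hq, rfl⟩ := (Ideal.mem_span_pow_iff_exists_isHomogeneous x y).1 hy
  rw [eval_eq]
  refine Ideal.sum_mem _ fun d hd => Ideal.mul_mem_left _ _ ?_
  have hdeg : ∑ i, d i = n := by
    have := hq (mem_support_iff.1 hd)
    rw [← this, Finsupp.weight_apply, Finsupp.sum_fintype _ _ (by simp)]
    simp
  obtain ⟨i, hi⟩ : ∃ i, p - 1 < d i := by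
    by_contra! h
    have : ∑ i, d i ≤ ∑ _i : ι, (p - 1) := Finset.sum_le_sum fun i _ => h i
    simp only [Finset.sum_const, Finset.card_univ, smul_eq_mul] at this
    omega
  have hdvd : x i ^ p ∣ ∏ j ∈ d.support, x j ^ d j := by
    refine (pow_dvd_pow _ (by omega)).trans (Finset.dvd_prod_of_mem (fun j => x j ^ d j) ?_)
    rw [Finsupp.mem_support_iff]
    omega
  exact Ideal.mem_of_dvd _ hdvd (Ideal.subset_span ⟨i, rfl⟩)

theorem isCompatiblySplit_sup {θ : S →+ S} {I J : Ideal S} (hI : IsCompatiblySplit θ I)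
    (hJ : IsCompatiblySplit θ J) : IsCompatiblySplit θ (I ⊔ J) := by
  intro f hf
  obtain ⟨a, ha, b, hb, rfl⟩ := Submodule.mem_sup.1 hf
  rw [map_add]
  exact Submodule.add_mem_sup (hI a ha) (hJ b hb)

/-- If `f` vanishes to order at least the number of generators of `H` away from `δ = 0`, then
`H : δ^∞` is stable under `g ↦ τ (f ^ (p - 1) * g)` for every `τ` linear over Frobenius. -/
theorem isCompatiblySplit_saturationBy {ι : Type*} [Fintype ι] (h : ι → S) (δ f : S) (p : ℕ)
    (hp : 0 < p) (τ θ : S →+ S) (hτ : ∀ a b, τ (a ^ p * b) = a * τ b)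
    (hθ : ∀ g, θ g = τ (f ^ (p - 1) * g)) (M : ℕ)
    (hf : δ ^ M * f ∈ Ideal.span (Set.range h) ^ Fintype.card ι) :
    IsCompatiblySplit θ ((Ideal.span (Set.range h)).saturationBy δ) := by
  rintro g ⟨N, hN⟩
  set H := Ideal.span (Set.range h)
  set L := M * (p - 1) + N
  -- `f ^ (p - 1)` has order `card ι * (p - 1)` and `g` adds one: just enough for the pigeonhole
  -- argument.
  have h1 : δ ^ L * (f ^ (p - 1) * g) ∈ H ^ (Fintype.card ι * (p - 1) + 1) := by
    have : δ ^ L * (f ^ (p - 1) * g) = (δ ^ M * f) ^ (p - 1) * (δ ^ N * g) := by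
      simp only [L]; ring
    rw [this, pow_succ, pow_mul]
    exact Ideal.mul_mem_mul (Ideal.pow_mem_pow hf _) hN
  -- The power of `δ` is completed to a `p`-th power, which `τ` returns as `δ ^ L`.
  have h2 : (δ ^ L) ^ p * (f ^ (p - 1) * g) ∈ Ideal.span (Set.range fun i => h i ^ p) := by
    have : (δ ^ L) ^ p * (f ^ (p - 1) * g)
        = (δ ^ L) ^ (p - 1) * (δ ^ L * (f ^ (p - 1) * g)) := by
      obtain ⟨q, rfl⟩ : ∃ q, p = q + 1 := ⟨p - 1, by omega⟩
      simp only [Nat.add_sub_cancel]; ring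
    rw [this]
    exact Ideal.mul_mem_left _ _ (mem_span_pow_of_mem_pow_span h p _ (by omega) h1)
  refine ⟨L, ?_⟩
  rw [hθ, ← hτ]
  obtain ⟨c, hc⟩ := (Ideal.mem_span_range_iff_exists_fun).1 h2
  rw [← hc, map_sum]
  refine Ideal.sum_mem _ fun i _ => ?_
  rw [mul_comm, hτ]
  exact Ideal.mul_mem_right _ _ (Ideal.subset_span ⟨i, rfl⟩)

end Saturation

/-! ### Determinants of small rank modulo an ideal. -/

section DeterminantOrder

variable {S : Type u} [CommRing S]

theorem prod_mem_pow_card {ι : Type*} [Fintype ι] (H : Ideal S) (g : ι → S) (s : Finset ι)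
    (hs : ∀ x ∈ s, g x ∈ H) : ∏ x, g x ∈ H ^ s.card := by
  classical
  rw [← Finset.prod_mul_prod_compl s g]
  refine Ideal.mul_mem_right _ _ ?_
  rw [← Finset.prod_const]
  exact Ideal.prod_mem_prod hs

/-- A determinant that has rank at most `r` modulo `H` lies in the corresponding power of `H`. -/
theorem det_mul_add_mem_pow {ι ρ : Type*} [Fintype ι] [DecidableEq ι] [Fintype ρ] [DecidableEq ρ]
    (H : Ideal S) (U : Matrix ι ρ S) (V : Matrix ρ ι S) (E : Matrix ι ι S)
    (hE : ∀ i j, E i j ∈ H) :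
    (U * V + E).det ∈ H ^ (Fintype.card ι - Fintype.card ρ) := by
  -- Schur complement. In each Leibniz term of the larger determinant at most `card ρ` indices of
  -- `ι` are sent to `ρ`; every other index of `ι` contributes an entry of `E`.
  have h1 : (U * V + E).det = (Matrix.fromBlocks 1 V (-U) E).det := by
    rw [Matrix.det_fromBlocks_one₁₁, Matrix.neg_mul, sub_neg_eq_add, add_comm]
  rw [h1, Matrix.det_apply]
  refine Ideal.sum_mem _ fun σ _ => ?_
  rw [Units.smul_def]
  refine zsmul_mem ?_ _
  set s : Finset (ρ ⊕ ι) := Finset.univ.filter fun x => x.isRight ∧ (σ x).isRight with hs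
  have hcard : Fintype.card ι - Fintype.card ρ ≤ s.card := by
    set s' : Finset (ρ ⊕ ι) := Finset.univ.filter fun x => x.isRight ∧ (σ x).isLeft with hs'
    have h2 : s.card + s'.card = Fintype.card ι := by
      rw [← Finset.card_union_of_disjoint]
      · have : s ∪ s' = Finset.univ.map Function.Embedding.inr := by
          ext x
          rcases x with x | x <;> simp [hs, hs']
          cases σ (Sum.inr x) <;> simp
        rw [this]; simp
      · rw [Finset.disjoint_left]
        intro x
        simp only [hs, hs', Finset.mem_filter, not_and]
        rintro ⟨_, _, h⟩ _ _
        simpa using h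
    have h3 : s'.card ≤ Fintype.card ρ := by
      have : s'.card = (s'.map σ.toEmbedding).card := by simp
      rw [this]
      have hsub : s'.map σ.toEmbedding ⊆ Finset.univ.map Function.Embedding.inl := by
        intro y hy
        obtain ⟨x, hx, rfl⟩ := Finset.mem_map.1 hy
        have := (Finset.mem_filter.1 hx).2.2
        obtain ⟨z, hz⟩ := Sum.isLeft_iff.1 this
        simp [hz]
      simpa using Finset.card_le_card hsub
    omega
  refine Ideal.pow_le_pow_right hcard (prod_mem_pow_card H _ s fun x hx => ?_)
  obtain ⟨hx1, hx2⟩ := (Finset.mem_filter.1 hx).2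
  obtain ⟨y, rfl⟩ := Sum.isRight_iff.1 hx1
  obtain ⟨z, hz⟩ := Sum.isRight_iff.1 hx2
  rw [hz]
  exact hE z y

/-- `x` vanishes to order at least `e` along `H`, away from `δ = 0`. -/
def VanishesToOrder (H : Ideal S) (δ x : S) (e : ℕ) : Prop := ∃ M, δ ^ M * x ∈ H ^ e

variable {H : Ideal S} {δ : S}

theorem VanishesToOrder.mul {x y : S} {e e' : ℕ} (hx : VanishesToOrder H δ x e)
    (hy : VanishesToOrder H δ y e') : VanishesToOrder H δ (x * y) (e + e') := by
  obtain ⟨M, hM⟩ := hx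
  obtain ⟨N, hN⟩ := hy
  refine ⟨M + N, ?_⟩
  rw [pow_add δ, mul_mul_mul_comm, pow_add]
  exact Ideal.mul_mem_mul hM hN

theorem VanishesToOrder.mono {x : S} {e e' : ℕ} (hx : VanishesToOrder H δ x e) (h : e' ≤ e) :
    VanishesToOrder H δ x e' :=
  hx.imp fun _ hM => Ideal.pow_le_pow_right h hM

theorem VanishesToOrder.prod {ι : Type*} (s : Finset ι) (x : ι → S) (e : ι → ℕ)
    (h : ∀ i ∈ s, VanishesToOrder H δ (x i) (e i)) :
    VanishesToOrder H δ (∏ i ∈ s, x i) (∑ i ∈ s, e i) := by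
  classical
  induction s using Finset.induction_on with
  | empty => exact ⟨0, by simp⟩
  | insert i s hi ih =>
    rw [Finset.prod_insert hi, Finset.sum_insert hi]
    exact (h i (Finset.mem_insert_self _ _)).mul
      (ih fun j hj => h j (Finset.mem_insert_of_mem hj))

/-- If the scaled matrix `δ N` has rank at most `r` modulo `H`, then `det N` vanishes to order at
least `size - r`. -/
theorem VanishesToOrder.det {ι ρ : Type*} [Fintype ι] [DecidableEq ι] [Fintype ρ] [DecidableEq ρ]
    (N : Matrix ι ι S) (s : ι → ℕ) (U : Matrix ι ρ S) (V : Matrix ρ ι S) (E : Matrix ι ι S)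
    (hE : ∀ i j, E i j ∈ H) (hN : ∀ i j, δ ^ s i * N i j = (U * V) i j + E i j) :
    VanishesToOrder H δ N.det (Fintype.card ι - Fintype.card ρ) := by
  refine ⟨∑ i, s i, ?_⟩
  have : δ ^ (∑ i, s i) * N.det = (U * V + E).det := by
    rw [← Finset.prod_pow_eq_pow_sum, ← Matrix.det_diagonal, ← Matrix.det_mul]
    congr 1
    ext i j
    rw [Matrix.diagonal_mul, hN, Matrix.add_apply]
  rw [this]
  exact det_mul_add_mem_pow H U V E hE

end DeterminantOrder

/-! ### Bordered minors. -/

section SchurDefect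

variable {S : Type u} [CommRing S] {μ τ ρ : Type*} [Fintype ρ] [DecidableEq ρ]

/-- The matrix of minors of `Y` that border the minor with rows `R` and columns `C`. -/
def schurDefect (Y : Matrix μ τ S) (R : ρ → μ) (C : ρ → τ) : Matrix μ τ S :=
  (Y.submatrix R C).det • Y -
    Y.submatrix id C * ((Y.submatrix R C).adjugate * Y.submatrix R id)

/-- A bordered minor with a repeated row vanishes. With the analogue for columns, this leaves only
`(m - r) * (t - r)` equations for the rank condition. -/
theorem schurDefect_row (Y : Matrix μ τ S) (R : ρ → μ) (C : ρ → τ) (l : ρ) (c : τ) :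
    schurDefect Y R C (R l) c = 0 := by
  have h : (Y.submatrix R C) * ((Y.submatrix R C).adjugate * Y.submatrix R id) =
      (Y.submatrix R C).det • Y.submatrix R id := by
    rw [← Matrix.mul_assoc, Matrix.mul_adjugate, Matrix.smul_mul, Matrix.one_mul]
  have h2 := congrFun (congrFun h l) c
  simp only [schurDefect, Matrix.sub_apply, Matrix.smul_apply]
  rw [sub_eq_zero]
  exact h2.symm

theorem schurDefect_col (Y : Matrix μ τ S) (R : ρ → μ) (C : ρ → τ) (i : μ) (l : ρ) :
    schurDefect Y R C i (C l) = 0 := by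
  have h : Y.submatrix id C * ((Y.submatrix R C).adjugate * (Y.submatrix R C)) =
      (Y.submatrix R C).det • Y.submatrix id C := by
    rw [Matrix.adjugate_mul, Matrix.mul_smul, Matrix.mul_one]
  have h2 := congrFun (congrFun h i) l
  simp only [schurDefect, Matrix.sub_apply, Matrix.smul_apply]
  rw [sub_eq_zero]
  exact h2.symm

theorem schurDefect_map {S' : Type v} [CommRing S'] (ψ : S →+* S') (Y : Matrix μ τ S)
    (R : ρ → μ) (C : ρ → τ) :
    (schurDefect Y R C).map ψ = schurDefect (Y.map ψ) R C := by
  ext i c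
  simp only [schurDefect, Matrix.sub_apply, Matrix.smul_apply, Matrix.map_apply, map_sub,
    smul_eq_mul, map_mul, Matrix.mul_apply, map_sum, Matrix.submatrix_apply, id]
  have h1 : ψ (Y.submatrix R C).det = ((Y.map ψ).submatrix R C).det := by
    rw [RingHom.map_det]; rfl
  have h2 : ∀ l l', ψ ((Y.submatrix R C).adjugate l l')
      = ((Y.map ψ).submatrix R C).adjugate l l' := by
    intro l l'
    have := RingHom.map_adjugate ψ (Y.submatrix R C)
    exact congrFun (congrFun this l) l'
  simp only [h1, h2]

/-- Each entry is `det A` times a Schur complement, with `A` the chosen submatrix; this is the minor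
that borders `A` by one row and one column. -/
theorem schurDefect_eq_zero {L : Type u} [Field L] (Y : Matrix μ τ L) (R : ρ → μ) (C : ρ → τ)
    (hδ : (Y.submatrix R C).det ≠ 0)
    (hmax : ∀ (R' : ρ ⊕ Unit → μ) (C' : ρ ⊕ Unit → τ), (Y.submatrix R' C').det = 0) :
    schurDefect Y R C = 0 := by
  ext i c
  have h := hmax (Sum.elim R fun _ => i) (Sum.elim C fun _ => c)
  set A := Y.submatrix R C with hA
  have : Invertible A := Matrix.invertibleOfIsUnitDet A (isUnit_iff_ne_zero.2 hδ)
  have hblock : Y.submatrix (Sum.elim R fun _ : Unit => i) (Sum.elim C fun _ : Unit => c) =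
      Matrix.fromBlocks A (Y.submatrix R fun _ => c) (Y.submatrix (fun _ => i) C)
        (Y.submatrix (fun _ => i) fun _ => c) := by
    ext (x | x) (y | y) <;> rfl
  rw [hblock, Matrix.det_fromBlocks₁₁] at h
  have h2 := (mul_eq_zero.1 h).resolve_left hδ
  rw [Matrix.det_unique] at h2
  have h3 : A.adjugate = A.det • ⅟A := by
    rw [Matrix.invOf_eq_nonsing_inv, Matrix.inv_def, smul_smul, Ring.mul_inverse_cancel _
      (isUnit_iff_ne_zero.2 hδ), one_smul]
  rw [Matrix.sub_apply, sub_eq_zero] at h2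
  simp only [schurDefect, Matrix.sub_apply, Matrix.smul_apply, Matrix.zero_apply]
  rw [← hA, h3, sub_eq_zero, Matrix.smul_mul, Matrix.mul_smul, Matrix.smul_apply]
  congr 1
  rw [← Matrix.mul_assoc]
  exact h2

end SchurDefect

/-! ### Minors that involve both matrices. -/

section MixedMatrix

variable {S : Type u} [CommRing S] {m t n : ℕ}

/-- A square submatrix of the block matrix with rows `(0, Y)` and `(Z, 1)`. -/
def mixedMatrix (Y : Matrix (Fin m) (Fin t) S) (Z : Matrix (Fin t) (Fin n) S) {a b k : ℕ}
    (i : Fin a → Fin m) (c : Fin a → Fin t) (d : Fin b → Fin t) (j : Fin b → Fin n)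
    (e : Fin k → Fin t) : Matrix (Fin a ⊕ Fin b ⊕ Fin k) (Fin a ⊕ Fin b ⊕ Fin k) S :=
  (Matrix.fromBlocks 0 Y Z 1).submatrix
    (Sum.elim (Sum.inl ∘ i) (Sum.elim (Sum.inr ∘ d) (Sum.inr ∘ e)))
    (Sum.elim (Sum.inr ∘ c) (Sum.elim (Sum.inl ∘ j) (Sum.inr ∘ e)))

/-- Up to the block `-(Y * Z)`, the block matrix is a column `(Y, 1)` times a row `(Z, 1)`, so it
has rank at most `t` modulo `H`. The order is the excess of the size over `t`. -/
theorem det_mixedMatrix_mem_pow (H : Ideal S) (Y : Matrix (Fin m) (Fin t) S)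
    (Z : Matrix (Fin t) (Fin n) S) {a b k : ℕ} (i : Fin a → Fin m) (c : Fin a → Fin t)
    (d : Fin b → Fin t) (j : Fin b → Fin n) (e : Fin k → Fin t) (hH : ∀ i j, (Y * Z) i j ∈ H) :
    (mixedMatrix Y Z i c d j e).det ∈ H ^ (a + b + k - t) := by
  set ro := (Sum.elim (Sum.inl ∘ i) (Sum.elim (Sum.inr ∘ d) (Sum.inr ∘ e)) :
    Fin a ⊕ Fin b ⊕ Fin k → Fin m ⊕ Fin t)
  set co := (Sum.elim (Sum.inr ∘ c) (Sum.elim (Sum.inl ∘ j) (Sum.inr ∘ e)) :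
    Fin a ⊕ Fin b ⊕ Fin k → Fin n ⊕ Fin t)
  have h1 : (Matrix.fromBlocks 0 Y Z 1 : Matrix (Fin m ⊕ Fin t) (Fin n ⊕ Fin t) S) =
      Matrix.fromRows Y 1 * Matrix.fromCols Z 1 + Matrix.fromBlocks (-(Y * Z)) 0 0 0 := by
    rw [Matrix.fromRows_mul_fromCols, Matrix.fromBlocks_add]
    simp
  have h2 : mixedMatrix Y Z i c d j e =
      (Matrix.fromRows Y 1).submatrix ro id * (Matrix.fromCols Z 1).submatrix id co +
        (Matrix.fromBlocks (-(Y * Z)) 0 0 0).submatrix ro co := by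
    rw [mixedMatrix, h1]
    rfl
  rw [h2]
  have h3 : ∀ x y, (Matrix.fromBlocks (-(Y * Z)) 0 0 0 :
      Matrix (Fin m ⊕ Fin t) (Fin n ⊕ Fin t) S) x y ∈ H := by
    rintro (x | x) (y | y)
    · exact H.neg_mem (hH x y)
    all_goals exact H.zero_mem
  have := det_mul_add_mem_pow H ((Matrix.fromRows Y 1).submatrix ro id)
    ((Matrix.fromCols Z 1).submatrix id co)
    ((Matrix.fromBlocks (-(Y * Z)) 0 0 0).submatrix ro co) fun x y => h3 _ _
  simpa [add_assoc] using this

/-- Once the rows that come from `Y` are multiplied by `δ`, the block matrix factors through `Fin t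
⊕ ρ` up to the entries of `E`. -/
theorem vanishesToOrder_det_mixedMatrix {ρ : Type*} [Fintype ρ] [DecidableEq ρ] (H : Ideal S)
    (δ : S) (Y : Matrix (Fin m) (Fin t) S) (Z : Matrix (Fin t) (Fin n) S) {a b k : ℕ}
    (i : Fin a → Fin m) (c : Fin a → Fin t) (d : Fin b → Fin t) (j : Fin b → Fin n)
    (e : Fin k → Fin t) (U : Matrix (Fin m) ρ S) (V : Matrix ρ (Fin t) S)
    (E : Matrix (Fin m) (Fin t) S) (hY : δ • Y = U * V + E) (hE : ∀ i j, E i j ∈ H) :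
    VanishesToOrder H δ (mixedMatrix Y Z i c d j e).det
      (a + b + k - (t + Fintype.card ρ)) := by
  set ro := (Sum.elim (Sum.inl ∘ i) (Sum.elim (Sum.inr ∘ d) (Sum.inr ∘ e)) :
    Fin a ⊕ Fin b ⊕ Fin k → Fin m ⊕ Fin t)
  set co := (Sum.elim (Sum.inr ∘ c) (Sum.elim (Sum.inl ∘ j) (Sum.inr ∘ e)) :
    Fin a ⊕ Fin b ⊕ Fin k → Fin n ⊕ Fin t)
  have h1 : (Matrix.fromBlocks 0 (δ • Y) Z 1 : Matrix (Fin m ⊕ Fin t) (Fin n ⊕ Fin t) S) =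
      (Matrix.fromBlocks 0 U 1 0 : Matrix (Fin m ⊕ Fin t) (Fin t ⊕ ρ) S) *
        (Matrix.fromBlocks Z 1 0 V : Matrix (Fin t ⊕ ρ) (Fin n ⊕ Fin t) S) +
          Matrix.fromBlocks 0 E 0 0 := by
    rw [Matrix.fromBlocks_multiply, Matrix.fromBlocks_add, hY]
    simp
  have h3 : ∀ x y, (Matrix.fromBlocks 0 E 0 0 :
      Matrix (Fin m ⊕ Fin t) (Fin n ⊕ Fin t) S) x y ∈ H := by
    rintro (x | x) (y | y)
    · exact H.zero_mem
    · exact hE x y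
    all_goals exact H.zero_mem
  have := VanishesToOrder.det (δ := δ) (mixedMatrix Y Z i c d j e)
    (fun x => if (ro x).isLeft then 1 else 0)
    ((Matrix.fromBlocks 0 U 1 0 : Matrix (Fin m ⊕ Fin t) (Fin t ⊕ ρ) S).submatrix ro id)
    ((Matrix.fromBlocks Z 1 0 V).submatrix id co)
    ((Matrix.fromBlocks 0 E 0 0).submatrix ro co) (fun x y => h3 _ _) (fun x y => by
      have h2 := congrFun (congrFun h1 (ro x)) (co y)
      have h4 : δ ^ (if (ro x).isLeft then 1 else 0) * mixedMatrix Y Z i c d j e x y =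
          (Matrix.fromBlocks 0 (δ • Y) Z 1 : Matrix (Fin m ⊕ Fin t) (Fin n ⊕ Fin t) S)
            (ro x) (co y) := by
        change _ * (Matrix.fromBlocks 0 Y Z 1 : Matrix (Fin m ⊕ Fin t) (Fin n ⊕ Fin t) S)
            (ro x) (co y) = _
        rcases ro x with x' | x' <;> rcases co y with y' | y' <;> simp
      rw [h4, h2]
      rfl)
  simpa [add_assoc] using this

theorem vanishesToOrder_det_submatrix {ρ : Type*} [Fintype ρ] [DecidableEq ρ] {μ τ : Type*}
    (H : Ideal S) (δ : S) (Y : Matrix μ τ S) {a : ℕ} (i : Fin a → μ) (c : Fin a → τ)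
    (U : Matrix μ ρ S) (V : Matrix ρ τ S) (E : Matrix μ τ S) (hY : δ • Y = U * V + E)
    (hE : ∀ i j, E i j ∈ H) :
    VanishesToOrder H δ (Y.submatrix i c).det (a - Fintype.card ρ) := by
  have := VanishesToOrder.det (δ := δ) (Y.submatrix i c) (fun _ => 1) (U.submatrix i id)
    (V.submatrix id c) (E.submatrix i c) (fun x y => hE _ _) (fun x y => by
      have h2 := congrFun (congrFun hY (i x)) (c y)
      rw [pow_one]
      exact h2)
  simpa using this

end MixedMatrix

/-! ### Orders of vanishing against codimensions. -/

section OrderArithmetic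

theorem sum_min_sub (t q r : ℕ) :
    ∑ d : Fin (t + q), (min t (t + q - d) - r) =
      ∑ d ∈ Finset.range t, (d + 1 - r) + q * (t - r) := by
  rw [Fin.sum_univ_eq_sum_range (fun d => min t (t + q - d) - r) (t + q),
    ← Finset.sum_range_reflect, Finset.sum_range_add]
  congr 1
  · refine Finset.sum_congr rfl fun d hd => ?_
    have := Finset.mem_range.1 hd
    omega
  · rw [Finset.sum_congr rfl (g := fun _ => t - r), Finset.sum_const, Finset.card_range,
      smul_eq_mul]
    intro d hd
    have := Finset.mem_range.1 hd
    omega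

theorem two_mul_sum_range_succ_sub (a r : ℕ) :
    2 * ∑ d ∈ Finset.range (a + r), (d + 1 - r) = a * (a + 1) := by
  induction a with
  | zero =>
    rw [Finset.sum_eq_zero, mul_zero, zero_mul]
    intro d hd
    have := Finset.mem_range.1 hd
    omega
  | succ a ih =>
    rw [Nat.add_right_comm, Finset.sum_range_succ, mul_add, ih]
    have : a + r + 1 - r = a + 1 := by omega
    rw [this]; ring

theorem two_mul_sum_range_sub (a r : ℕ) :
    2 * ∑ d ∈ Finset.range (a + r), (d - r) + a = a * a := by
  induction a with
  | zero =>
    rw [Finset.sum_eq_zero, mul_zero, mul_zero, add_zero]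
    intro d hd
    have := Finset.mem_range.1 hd
    omega
  | succ a ih =>
    rw [Nat.add_right_comm, Finset.sum_range_succ]
    have : a + r - r = a := by omega
    rw [this]; linarith

/-- The codimension of `rank Y ≤ r` is compared with the orders of the diagonal minors of `Y` and of
the minors of `Y * Z`. With `t = a + r` and `m = t + q` both sides equal `a * (a + q)`. -/
theorem det_order_count {m t r : ℕ} (hm : t ≤ m) (hr : r ≤ t) :
    (m - r) * (t - r) ≤
      ∑ d : Fin m, (min t (m - d) - r) + ∑ k : Fin t, ((k : ℕ) - r) := by
  obtain ⟨q, rfl⟩ := Nat.exists_eq_add_of_le hm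
  obtain ⟨a, rfl⟩ := Nat.exists_eq_add_of_le' hr
  rw [sum_min_sub, Fin.sum_univ_eq_sum_range (fun k => k - r) (a + r)]
  have h1 := two_mul_sum_range_succ_sub a r
  have h2 := two_mul_sum_range_sub a r
  have h3 : a + r - r = a := by omega
  have h4 : a + r + q - r = a + q := by omega
  rw [h3, h4]
  nlinarith

/-- The three sums come from the minors of `Y` (rank at most `r`), of `Z` (rank at most `t - r`) and
of `Y * Z`. With `t = a + r`, `m = t + q`, `n = t + q'` both sides equal `a² + ar + r² + qa + q'r`.
-/
theorem nullcone_order_count {m t n r : ℕ} (hm : t ≤ m) (hn : t ≤ n) (hr : r ≤ t) :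
    (m - r) * (t - r) + r * n ≤
      ∑ d : Fin m, (min t (m - d) - r) + ∑ d : Fin n, (min t (n - d) - (t - r)) +
        ∑ k : Fin t, (k : ℕ) := by
  obtain ⟨q, rfl⟩ := Nat.exists_eq_add_of_le hm
  obtain ⟨q', rfl⟩ := Nat.exists_eq_add_of_le hn
  obtain ⟨a, rfl⟩ := Nat.exists_eq_add_of_le' hr
  rw [sum_min_sub, sum_min_sub, Fin.sum_univ_eq_sum_range (fun k => k) (a + r)]
  have h1 := two_mul_sum_range_succ_sub a r
  have h2 := two_mul_sum_range_succ_sub r a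
  rw [add_comm r a] at h2
  have h5 := two_mul_sum_range_sub (a + r) 0
  simp only [add_zero, Nat.sub_zero] at h5
  have h3 : a + r - r = a := by omega
  have h4 : a + r + q - r = a + q := by omega
  have h6 : a + r - a = r := by omega
  rw [h3, h4, h6]
  nlinarith

end OrderArithmetic

/-! ### The splitting polynomial and its order along the strata. -/

section SplittingPolynomial

variable {S : Type u} [CommRing S] {m t n : ℕ}

/-- The minor of `Y` on the diagonal through the entry `(d, 0)`. -/
def diagMinorY (Y : Matrix (Fin m) (Fin t) S) (d : Fin m) : S :=
  (Y.submatrix (fun l : Fin (min t (m - d)) => (⟨d + l, by omega⟩ : Fin m))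
    (Fin.castLE (min_le_left _ _))).det

/-- The minor of `Z` on the diagonal through the entry `(0, d)`. -/
def diagMinorZ (Z : Matrix (Fin t) (Fin n) S) (d : Fin n) : S :=
  (Z.submatrix (Fin.castLE (min_le_left _ _))
    (fun l : Fin (min t (n - d)) => (⟨d + l, by omega⟩ : Fin n))).det

/-- Up to sign, the leading principal `k`-minor of `Y * Z`. -/
def productMinor (hm : t ≤ m) (hn : t ≤ n) (Y : Matrix (Fin m) (Fin t) S)
    (Z : Matrix (Fin t) (Fin n) S) (k : Fin t) : S :=
  (mixedMatrix Y Z (Fin.castLE (k.2.le.trans hm))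
    (fun l : Fin k => (⟨t - k + l, by omega⟩ : Fin t))
    (fun l : Fin k => (⟨t - k + l, by omega⟩ : Fin t)) (Fin.castLE (k.2.le.trans hn))
    (Fin.castLE (Nat.sub_le t k))).det

/-- The polynomial whose `(p - 1)`-st power gives the splitting. -/
def splittingPoly (hm : t ≤ m) (hn : t ≤ n) (Y : Matrix (Fin m) (Fin t) S)
    (Z : Matrix (Fin t) (Fin n) S) : S :=
  (∏ d, diagMinorY Y d) * (∏ d, diagMinorZ Z d) * ∏ k, productMinor hm hn Y Z k

variable {r : ℕ} (Y : Matrix (Fin m) (Fin t) S) (Z : Matrix (Fin t) (Fin n) S)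
  (R : Fin r ↪ Fin m) (C : Fin r ↪ Fin t)

/-- Equations of the locus `rank Y ≤ r` where the minor of `Y` with rows `R` and columns `C` does
not vanish. -/
def rankGens : ((Set.range R)ᶜ : Set (Fin m)) × ((Set.range C)ᶜ : Set (Fin t)) → S :=
  fun x => schurDefect Y R C x.1 x.2

/-- Equations of the locus `Y * Z = 0`, `rank Y ≤ r` where the minor of `Y` with rows `R` and
columns `C` does not vanish. -/
def nullconeGens : ((Set.range R)ᶜ : Set (Fin m)) × ((Set.range C)ᶜ : Set (Fin t)) ⊕
    Fin r × Fin n → S :=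
  Sum.elim (rankGens Y R C) fun x => (Y * Z) (R x.1) x.2

theorem schurDefect_mem_of_rankGens (H : Ideal S) (hH : ∀ x, rankGens Y R C x ∈ H) (i : Fin m)
    (c : Fin t) : schurDefect Y R C i c ∈ H := by
  by_cases hi : i ∈ Set.range R
  · obtain ⟨l, rfl⟩ := hi
    rw [schurDefect_row]; exact H.zero_mem
  by_cases hc : c ∈ Set.range C
  · obtain ⟨l, rfl⟩ := hc
    rw [schurDefect_col]; exact H.zero_mem
  exact hH ⟨⟨i, hi⟩, ⟨c, hc⟩⟩

theorem smul_eq_add_schurDefect : (Y.submatrix R C).det • Y =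
    Y.submatrix id C * ((Y.submatrix R C).adjugate * Y.submatrix R id) + schurDefect Y R C := by
  rw [schurDefect]; abel

theorem card_rankGens : Fintype.card (((Set.range R)ᶜ : Set (Fin m)) ×
    ((Set.range C)ᶜ : Set (Fin t))) = (m - r) * (t - r) := by
  rw [Fintype.card_prod, Fintype.card_compl_set, Fintype.card_compl_set,
    Set.card_range_of_injective R.injective, Set.card_range_of_injective C.injective]
  simp

theorem vanishesToOrder_diagMinorY (H : Ideal S) (hH : ∀ x, rankGens Y R C x ∈ H) (d : Fin m) :
    VanishesToOrder H (Y.submatrix R C).det (diagMinorY Y d) (min t (m - d) - r) := by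
  refine (vanishesToOrder_det_submatrix H (Y.submatrix R C).det Y _ _ _ _ _
    (smul_eq_add_schurDefect Y R C) (schurDefect_mem_of_rankGens Y R C H hH)).mono ?_
  rw [Fintype.card_fin]

theorem vanishesToOrder_splittingPoly_rankGens (hm : t ≤ m) (hn : t ≤ n) :
    VanishesToOrder (Ideal.span (Set.range (rankGens Y R C))) (Y.submatrix R C).det
      (splittingPoly hm hn Y Z) ((m - r) * (t - r)) := by
  set H := Ideal.span (Set.range (rankGens Y R C))
  have hH : ∀ x, rankGens Y R C x ∈ H := fun x => Ideal.subset_span ⟨x, rfl⟩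
  have hr : r ≤ t := by simpa using Fintype.card_le_of_embedding C
  have h1 := VanishesToOrder.prod Finset.univ _ _ fun d _ =>
    vanishesToOrder_diagMinorY Y R C H hH d
  have h2 : VanishesToOrder H (Y.submatrix R C).det (∏ d, diagMinorZ Z d) 0 := ⟨0, by simp⟩
  have h3 := VanishesToOrder.prod Finset.univ (productMinor hm hn Y Z) (fun k => (k : ℕ) - r)
    fun k _ => by
      refine (vanishesToOrder_det_mixedMatrix H (Y.submatrix R C).det Y Z _ _ _ _ _ _ _ _
        (smul_eq_add_schurDefect Y R C) (schurDefect_mem_of_rankGens Y R C H hH)).mono ?_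
      rw [Fintype.card_fin]
      omega
  exact ((h1.mul h2).mul h3).mono (by simpa using det_order_count hm hr)

/-- Modulo the defect, `δ` times any row of `Y` is a combination of the rows in `R`. Hence `r * n`
entries of `Y * Z` suffice as equations. -/
theorem productIdeal_smul_mem (H : Ideal S) (hH : ∀ x, nullconeGens Y Z R C x ∈ H) (i : Fin m)
    (j : Fin n) : (Y.submatrix R C).det * (Y * Z) i j ∈ H := by
  have h1 : (Y.submatrix R C).det • (Y * Z) =
      Y.submatrix id C * (Y.submatrix R C).adjugate * (Y * Z).submatrix R id +
        schurDefect Y R C * Z := by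
    rw [← Matrix.smul_mul, smul_eq_add_schurDefect Y R C, Matrix.add_mul, Matrix.mul_assoc,
      Matrix.mul_assoc, Matrix.mul_assoc]
    rfl
  have h2 := congrFun (congrFun h1 i) j
  rw [Matrix.smul_apply, smul_eq_mul] at h2
  rw [h2, Matrix.add_apply, Matrix.mul_apply, Matrix.mul_apply]
  refine H.add_mem (H.sum_mem fun l _ => H.mul_mem_left _ (hH (Sum.inr (l, j))))
    (H.sum_mem fun l _ => H.mul_mem_right _ ?_)
  exact schurDefect_mem_of_rankGens Y R C H (fun x => hH (Sum.inl x)) i l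

/-- The product `adj(A) * Y_R` is `δ` times the identity on the columns `C`, and its product with
`Z` has entries in `H`. This solves, up to the factor `δ`, for the rows of `Z` in `C` in terms of
the `t - r` other rows, so `Z` has rank at most `t - r`. -/
theorem smul_eq_add_kernel :
    ∃ (U : Matrix (Fin t) ((Set.range C)ᶜ : Set (Fin t)) S)
      (V : Matrix ((Set.range C)ᶜ : Set (Fin t)) (Fin n) S) (E : Matrix (Fin t) (Fin n) S),
      (Y.submatrix R C).det • Z = U * V + E ∧
        ∀ H : Ideal S, (∀ x, nullconeGens Y Z R C x ∈ H) → ∀ c j, E c j ∈ H := by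
  classical
  set A := Y.submatrix R C with hA
  set V' : Matrix (Fin r) (Fin t) S := A.adjugate * Y.submatrix R id with hV'
  have hVC : ∀ l l', V' l (C l') = if l = l' then A.det else 0 := by
    intro l l'
    have : A.adjugate * A = A.det • 1 := Matrix.adjugate_mul A
    have := congrFun (congrFun this l) l'
    rw [Matrix.smul_apply, Matrix.one_apply, smul_eq_mul, mul_ite, mul_one, mul_zero] at this
    exact this
  refine ⟨Matrix.of fun c x =>
      if h : c ∈ Set.range C then -V' h.choose x else if c = x then A.det else 0,
    Matrix.of fun x j => Z x j,
    Matrix.of fun c j => if h : c ∈ Set.range C then (V' * Z) h.choose j else 0, ?_, ?_⟩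
  · ext c j
    rw [Matrix.smul_apply, Matrix.add_apply, Matrix.mul_apply, smul_eq_mul]
    simp only [Matrix.of_apply]
    by_cases h : c ∈ Set.range C
    · simp only [h, dif_pos]
      set l := h.choose with hl
      have hcl : C l = c := h.choose_spec
      have h1 : ∑ x : {x // x ∈ Set.range C}, V' l x * Z x j = A.det * Z c j := by
        rw [Fintype.sum_eq_single ⟨c, h⟩]
        · have := hVC l l
          rw [hcl, if_pos rfl] at this
          rw [this]
        · rintro ⟨_, l', rfl⟩ hne
          rw [hVC, if_neg, zero_mul]
          rintro rfl
          exact hne (Subtype.ext hcl)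
      have h2 : (V' * Z) l j = A.det * Z c j +
          ∑ x : ((Set.range C)ᶜ : Set (Fin t)), V' l x * Z x j := by
        rw [Matrix.mul_apply, ← h1,
          ← Fintype.sum_subtype_add_sum_subtype (· ∈ Set.range C) fun x => V' l x * Z x j]
        congr 1
        exact Finset.sum_congr (by ext; simp) fun _ _ => rfl
      rw [h2]
      simp only [neg_mul, Finset.sum_neg_distrib]
      ring
    · simp only [h, dif_neg, not_false_eq_true, add_zero]
      rw [Fintype.sum_eq_single ⟨c, h⟩]
      · simp
      · intro x hx
        rw [if_neg, zero_mul]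
        rintro rfl
        exact hx rfl
  · intro H hH c j
    rw [Matrix.of_apply]
    by_cases h : c ∈ Set.range C
    · simp only [h, dif_pos]
      rw [hV', Matrix.mul_assoc, Matrix.mul_apply]
      exact H.sum_mem fun l _ => H.mul_mem_left _ (hH (Sum.inr (l, j)))
    · simp only [h, dif_neg, not_false_eq_true, H.zero_mem]

theorem vanishesToOrder_splittingPoly_nullconeGens (hm : t ≤ m) (hn : t ≤ n) :
    VanishesToOrder (Ideal.span (Set.range (nullconeGens Y Z R C))) (Y.submatrix R C).det
      (splittingPoly hm hn Y Z) ((m - r) * (t - r) + r * n) := by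
  set H := Ideal.span (Set.range (nullconeGens Y Z R C))
  have hH : ∀ x, nullconeGens Y Z R C x ∈ H := fun x => Ideal.subset_span ⟨x, rfl⟩
  have hr : r ≤ t := by simpa using Fintype.card_le_of_embedding C
  have h1 := VanishesToOrder.prod Finset.univ _ _ fun d _ =>
    vanishesToOrder_diagMinorY Y R C H (fun x => hH (Sum.inl x)) d
  have h2 := VanishesToOrder.prod (H := H) (δ := (Y.submatrix R C).det) Finset.univ
    (diagMinorZ Z) (fun d => min t (n - d) - (t - r)) fun d _ => by
      obtain ⟨U, V, E, hZ, hE⟩ := smul_eq_add_kernel Y Z R C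
      refine (vanishesToOrder_det_submatrix H (Y.submatrix R C).det Z _ _ U V E hZ
        (hE H hH)).mono ?_
      rw [Fintype.card_compl_set, Set.card_range_of_injective C.injective]
      simp
  have h3 := VanishesToOrder.prod (H := H) (δ := (Y.submatrix R C).det) Finset.univ
    (productMinor hm hn Y Z) (fun k => (k : ℕ)) fun k _ => by
      set W := entriesIdeal (Y * Z)
      have hW : ∀ i j, (Y * Z) i j ∈ W := fun i j => Ideal.subset_span ⟨i, j, rfl⟩
      have hmem := det_mixedMatrix_mem_pow W Y Z (Fin.castLE (k.2.le.trans hm))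
        (fun l : Fin k => (⟨t - k + l, by omega⟩ : Fin t))
        (fun l : Fin k => (⟨t - k + l, by omega⟩ : Fin t)) (Fin.castLE (k.2.le.trans hn))
        (Fin.castLE (Nat.sub_le t k)) hW
      have hk : (k : ℕ) + k + (t - k) - t = k := by omega
      rw [hk] at hmem
      -- The minor lies in `W ^ k` and `δ * W` lies in `H`, so the factor `δ ^ k` suffices.
      have hle : Ideal.span {(Y.submatrix R C).det} * W ≤ H := by
        rw [Ideal.span_singleton_mul_le_iff]
        intro z hz
        have : W ≤ Submodule.comap (LinearMap.mulLeft S (Y.submatrix R C).det) H := by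
          refine Ideal.span_le.2 ?_
          rintro _ ⟨i, j, rfl⟩
          exact productIdeal_smul_mem Y Z R C H hH i j
        exact this hz
      refine ⟨k, Ideal.pow_right_mono hle k ?_⟩
      rw [mul_pow]
      exact Ideal.mul_mem_mul (Ideal.pow_mem_pow (Ideal.mem_span_singleton_self _) _) hmem
  exact ((h1.mul h2).mul h3).mono (nullcone_order_count hm hn hr)

end SplittingPolynomial

/-! ### Leading monomials and reduction. -/

section LeadingMonomial

open MvPolynomial

variable {K : Type u} [Field K] {σ : Type v}

/-- `e` is the unique monomial of `g` of largest weight, and has coefficient one. -/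
def HasLead (w : σ → ℕ) (g : MvPolynomial σ K) (e : σ →₀ ℕ) : Prop :=
  coeff e g = 1 ∧
    ∀ e', coeff e' g ≠ 0 → e' ≠ e → Finsupp.weight w e' < Finsupp.weight w e

variable {w : σ → ℕ}

theorem HasLead.weight_le {g : MvPolynomial σ K} {e e' : σ →₀ ℕ} (h : HasLead w g e)
    (he' : coeff e' g ≠ 0) : Finsupp.weight w e' ≤ Finsupp.weight w e := by
  by_cases hne : e' = e
  · rw [hne]
  · exact (h.2 e' he' hne).le

theorem hasLead_one : HasLead w (1 : MvPolynomial σ K) 0 := by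
  classical
  refine ⟨by simp, fun e' he' hne => ?_⟩
  rw [coeff_one, if_neg (Ne.symm hne)] at he'
  exact absurd rfl he'

theorem HasLead.mul {g g' : MvPolynomial σ K} {e e' : σ →₀ ℕ} (h : HasLead w g e)
    (h' : HasLead w g' e') : HasLead w (g * g') (e + e') := by
  classical
  constructor
  · rw [coeff_mul, Finset.sum_eq_single (e, e')]
    · simp [h.1, h'.1]
    · rintro ⟨a, b⟩ hab hne
      by_contra h0
      have hab : a + b = e + e' := by simpa using hab
      have ha : coeff a g ≠ 0 := left_ne_zero_of_mul h0
      have hb : coeff b g' ≠ 0 := right_ne_zero_of_mul h0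
      have hw := congrArg (Finsupp.weight w) hab
      rw [map_add, map_add] at hw
      have ha' := h.weight_le ha
      have hb' := h'.weight_le hb
      have hae : a = e := by
        by_contra hae
        have := h.2 a ha hae
        omega
      exact hne (by simpa [hae] using hab)
    · simp
  · intro f hf hne
    rw [coeff_mul] at hf
    obtain ⟨⟨a, b⟩, hab, h0⟩ := Finset.exists_ne_zero_of_sum_ne_zero hf
    have hab : a + b = f := by simpa using hab
    have ha : coeff a g ≠ 0 := left_ne_zero_of_mul h0
    have hb : coeff b g' ≠ 0 := right_ne_zero_of_mul h0
    rw [← hab, map_add, map_add]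
    by_cases hae : a = e
    · have hbe : b ≠ e' := by
        rintro rfl
        exact hne (by rw [← hab, hae])
      exact add_lt_add_of_le_of_lt (h.weight_le ha) (h'.2 b hb hbe)
    · exact add_lt_add_of_lt_of_le (h.2 a ha hae) (h'.weight_le hb)

theorem HasLead.prod {ι : Type*} (s : Finset ι) (g : ι → MvPolynomial σ K) (e : ι → σ →₀ ℕ)
    (h : ∀ i ∈ s, HasLead w (g i) (e i)) : HasLead w (∏ i ∈ s, g i) (∑ i ∈ s, e i) := by
  classical
  induction s using Finset.induction_on with
  | empty => simpa using hasLead_one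
  | insert i s hi ih =>
    rw [Finset.prod_insert hi, Finset.sum_insert hi]
    exact (h i (Finset.mem_insert_self _ _)).mul
      (ih fun j hj => h j (Finset.mem_insert_of_mem hj))

theorem HasLead.pow {g : MvPolynomial σ K} {e : σ →₀ ℕ} (h : HasLead w g e) (q : ℕ) :
    HasLead w (g ^ q) (q • e) := by
  simpa using HasLead.prod (Finset.range q) (fun _ => g) (fun _ => e) fun _ _ => h

theorem hasLead_sum_monomial {ι : Type*} [Fintype ι] (E : ι → σ →₀ ℕ) (a : ι → K) (s₀ : ι)
    (h1 : a s₀ = 1)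
    (h2 : ∀ s, s ≠ s₀ → a s ≠ 0 → Finsupp.weight w (E s) < Finsupp.weight w (E s₀)) :
    HasLead w (∑ s, monomial (E s) (a s)) (E s₀) := by
  classical
  constructor
  · rw [coeff_sum, Fintype.sum_eq_single s₀]
    · simp [h1]
    · intro s hs
      rw [coeff_monomial]
      split_ifs with he
      · by_contra h0
        have := h2 s hs h0
        rw [he] at this
        exact lt_irrefl _ this
      · rfl
  · intro e' he' hne
    rw [coeff_sum] at he'
    obtain ⟨s, _, hs⟩ := Finset.exists_ne_zero_of_sum_ne_zero he'
    rw [coeff_monomial] at hs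
    split_ifs at hs with h
    · subst h
      exact h2 s (by rintro rfl; exact hne rfl) hs
    · exact absurd rfl hs

/-- Reduction modulo an ideal: monomials divisible by the leading monomial of an element of `I`
can be avoided. -/
theorem exists_reduced_representative (w : σ → ℕ) (I : Ideal (MvPolynomial σ K))
    (bad : (σ →₀ ℕ) → Prop)
    (hbad : ∀ e, bad e → ∃ q ∈ I, ∃ e₀ ≤ e, HasLead w q e₀) (g : MvPolynomial σ K) :
    ∃ g', g - g' ∈ I ∧ ∀ e ∈ g'.support, ¬ bad e := by
  classical
  set T : Submodule K (MvPolynomial σ K) :=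
    I.restrictScalars K ⊔ restrictSupport K {e | ¬ bad e} with hT
  -- Strong induction on the weight: subtracting a multiple of `q` replaces a bad monomial by
  -- monomials of smaller weight.
  have key : ∀ N : ℕ, ∀ e : σ →₀ ℕ, Finsupp.weight w e = N →
      (monomial e 1 : MvPolynomial σ K) ∈ T := by
    intro N
    induction N using Nat.strong_induction_on with
    | _ N ih =>
      intro e he
      by_cases hb : bad e
      · obtain ⟨q, hq, e₀, hle, hlead⟩ := hbad e hb
        have hl : HasLead w (monomial (e - e₀) 1 * q) e := by
          have h1 : HasLead w (monomial (e - e₀) 1 : MvPolynomial σ K) (e - e₀) := by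
            have := hasLead_sum_monomial (K := K) (w := w) (fun _ : Unit => e - e₀)
              (fun _ => (1 : K)) () rfl (fun s hs => absurd rfl hs)
            simpa using this
          have := h1.mul hlead
          rwa [tsub_add_cancel_of_le hle] at this
        set Q := monomial (e - e₀) 1 * q with hQ
        have hQI : Q ∈ T := Submodule.mem_sup_left (I.mul_mem_left _ hq)
        have hrest : Q - monomial e 1 ∈ T := by
          rw [← support_sum_monomial_coeff (Q - monomial e 1)]
          refine Submodule.sum_mem _ fun e' he' => ?_
          have hc : monomial e' (coeff e' (Q - monomial e 1)) =
              coeff e' (Q - monomial e 1) • (monomial e' 1 : MvPolynomial σ K) := by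
            rw [smul_monomial, smul_eq_mul, mul_one]
          rw [hc]
          refine T.smul_mem _ (ih _ ?_ e' rfl)
          rw [mem_support_iff, coeff_sub] at he'
          have hne : e' ≠ e := by
            rintro rfl
            rw [hl.1, coeff_monomial, if_pos rfl, sub_self] at he'
            exact he' rfl
          rw [coeff_monomial, if_neg (Ne.symm hne), sub_zero] at he'
          rw [← he]
          exact hl.2 e' he' hne
        have : (monomial e 1 : MvPolynomial σ K) = Q - (Q - monomial e 1) := by ring
        rw [this]
        exact T.sub_mem hQI hrest
      · refine Submodule.mem_sup_right ?_
        rw [mem_restrictSupport_iff K]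
        intro e' he'
        have := support_monomial_subset he'
        rw [Finset.mem_singleton] at this
        rwa [this]
  have hg : g ∈ T := by
    rw [g.as_sum]
    refine Submodule.sum_mem _ fun e _ => ?_
    have hc : monomial e (coeff e g) = coeff e g • (monomial e 1 : MvPolynomial σ K) := by
      rw [smul_monomial, smul_eq_mul, mul_one]
    rw [hc]
    exact T.smul_mem _ (key _ e rfl)
  obtain ⟨x, hx, y, hy, rfl⟩ := Submodule.mem_sup.1 hg
  refine ⟨y, by simpa using hx, fun e he => ?_⟩
  exact (mem_restrictSupport_iff K).1 hy he

end LeadingMonomial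

/-! ### The rearrangement inequality. -/

section Rearrangement

/-- In the case of equality, strict monotonicity of `x` and `y` makes the permutation increasing,
hence trivial. -/
theorem sum_perm_mul_lt {a : ℕ} (x y : Fin a → ℕ) (hx : StrictMono x) (hy : StrictMono y)
    (s : Equiv.Perm (Fin a)) : ∑ l, x (s l) * y l ≤ ∑ l, x l * y l ∧
      (∑ l, x (s l) * y l = ∑ l, x l * y l → s = 1) := by
  have hmv : Monovary x y := fun i j hij => hx.monotone (hy.lt_iff_lt.1 hij).le
  refine ⟨hmv.sum_comp_perm_mul_le_sum_mul, fun h => ?_⟩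
  have h1 := hmv.sum_comp_perm_mul_eq_sum_mul_iff.1 h
  have h2 : StrictMono s := by
    intro l l' hll
    have := h1 (hy hll)
    exact lt_of_le_of_ne (hx.le_iff_le.1 this) fun h => hll.ne (s.injective h)
  ext l
  have h3 : (⇑s) = id := StrictMono.range_inj h2 strictMono_id |>.1 (by simp [s.surjective.range_eq])
  rw [h3]; rfl

end Rearrangement

/-! ### Leading monomials of mixed minors. -/

section MixedLead

open MvPolynomial

/-- A factor making the column index of `Y` and the row index of `Z` dominate in the weights. -/
def weightFactor (m t n : ℕ) : ℕ := 3 * t * (m * t + t * n) + 1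

/-- Weights of the variables for which leading monomials of minors lie on diagonals. -/
def diagWeight (m t n : ℕ) : (Fin m × Fin t) ⊕ (Fin t × Fin n) → ℕ :=
  Sum.elim (fun x => weightFactor m t n * (2 * x.2) + x.1 * x.2)
    (fun x => weightFactor m t n * (2 * x.1) + x.1 * x.2)

variable {m t n : ℕ}

/-- The exponents of the entries of the block matrix with rows `(0, Y)` and `(Z, 1)`. -/
noncomputable def blockExponent : Fin m ⊕ Fin t → Fin n ⊕ Fin t →
    ((Fin m × Fin t) ⊕ (Fin t × Fin n) →₀ ℕ)
  | Sum.inl i, Sum.inr c => Finsupp.single (Sum.inl (i, c)) 1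
  | Sum.inr c, Sum.inl j => Finsupp.single (Sum.inr (c, j)) 1
  | _, _ => 0

/-- The coefficients of the entries of the block matrix with rows `(0, Y)` and `(Z, 1)`. -/
def blockCoeff (K : Type u) [Field K] : Fin m ⊕ Fin t → Fin n ⊕ Fin t → K
  | Sum.inl _, Sum.inl _ => 0
  | Sum.inr c, Sum.inr c' => if c = c' then 1 else 0
  | _, _ => 1

theorem fromBlocks_eq_monomial (K : Type u) [Field K] (x : Fin m ⊕ Fin t) (y : Fin n ⊕ Fin t) :
    Matrix.fromBlocks 0 (matY K m t n) (matZ K m t n) 1 x y =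
      monomial (blockExponent x y) (blockCoeff K x y) := by
  rcases x with x | x <;> rcases y with y | y
  · simp [blockExponent, blockCoeff]
  · simp [blockExponent, blockCoeff, matY, X]
  · simp [blockExponent, blockCoeff, matZ, X]
  · simp only [Matrix.fromBlocks_apply₂₂, blockExponent, blockCoeff, Matrix.one_apply]
    split_ifs <;> simp

/-- The dominant part of the weight of an entry of the block matrix. -/
def blockLinear : Fin m ⊕ Fin t → Fin n ⊕ Fin t → ℕ
  | Sum.inl _, Sum.inr c => 2 * c
  | Sum.inr c, Sum.inl _ => 2 * c
  | _, _ => 0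

/-- The second part of the weight of an entry of the block matrix. -/
def blockQuadratic : Fin m ⊕ Fin t → Fin n ⊕ Fin t → ℕ
  | Sum.inl i, Sum.inr c => i * c
  | Sum.inr c, Sum.inl j => c * j
  | _, _ => 0

theorem weight_blockExponent (x : Fin m ⊕ Fin t) (y : Fin n ⊕ Fin t) :
    Finsupp.weight (diagWeight m t n) (blockExponent x y) =
      weightFactor m t n * blockLinear x y + blockQuadratic x y := by
  rcases x with x | x <;> rcases y with y | y <;>
    simp [blockExponent, blockLinear, blockQuadratic, Finsupp.weight_single, diagWeight]

theorem blockQuadratic_le (x : Fin m ⊕ Fin t) (y : Fin n ⊕ Fin t) :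
    blockQuadratic x y ≤ m * t + t * n := by
  rcases x with x | x <;> rcases y with y | y <;> simp only [blockQuadratic]
  · positivity
  · exact (Nat.mul_le_mul x.2.le y.2.le).trans (Nat.le_add_right _ _)
  · exact (Nat.mul_le_mul x.2.le y.2.le).trans (Nat.le_add_left _ _)
  · positivity

theorem sum_blockQuadratic_lt {ι : Type*} [Fintype ι] (hι : Fintype.card ι ≤ 3 * t)
    (x : ι → Fin m ⊕ Fin t) (y : ι → Fin n ⊕ Fin t) :
    ∑ l, blockQuadratic (x l) (y l) < weightFactor m t n := by
  have h1 : ∑ l, blockQuadratic (x l) (y l) ≤ ∑ _l : ι, (m * t + t * n) :=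
    Finset.sum_le_sum fun l _ => blockQuadratic_le _ _
  rw [Finset.sum_const, Finset.card_univ, smul_eq_mul] at h1
  have h2 := Nat.mul_le_mul_right (m * t + t * n) hι
  rw [weightFactor]
  omega

/-- A permutation of a sum that preserves the first summand restricts to it. -/
theorem exists_perm_of_preserves {α β : Type*} [Finite α] (σ : Equiv.Perm β) (ι : α → β)
    (hι : Function.Injective ι) (h : ∀ l, ∃ l', σ (ι l) = ι l') :
    ∃ s : Equiv.Perm α, ∀ l, σ (ι l) = ι (s l) := by
  choose s hs using h
  have hinj : Function.Injective s := fun l l' hll =>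
    hι (σ.injective (by rw [hs, hs, hll]))
  exact ⟨Equiv.ofBijective s ((Finite.injective_iff_bijective).1 hinj), hs⟩

variable {a b k : ℕ} (i : Fin a → Fin m) (c : Fin a → Fin t) (d : Fin b → Fin t)
  (j : Fin b → Fin n) (hk : k ≤ t)

/-- The exponent of the product of the diagonal entries of a mixed matrix. -/
noncomputable def chainExponent : (Fin m × Fin t) ⊕ (Fin t × Fin n) →₀ ℕ :=
  ∑ l, Finsupp.single (Sum.inl (i l, c l)) 1 + ∑ l, Finsupp.single (Sum.inr (d l, j l)) 1

/-- The dominant part of the weight is bounded by potentials on rows and columns that are tight only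
on the three diagonal blocks, so a maximal permutation preserves these blocks. It fixes the identity
block pointwise, where other entries vanish, and the rearrangement inequality for the quadratic part
makes it trivial on the blocks of `Y` and `Z`. -/
theorem hasLead_det_mixedMatrix (K : Type u) [Field K] (hi : StrictMono i) (hc : StrictMono c)
    (hd : StrictMono d) (hj : StrictMono j) (hck : ∀ l, k ≤ (c l : ℕ))
    (hdk : ∀ l, k ≤ (d l : ℕ)) :
    HasLead (diagWeight m t n)
      (mixedMatrix (matY K m t n) (matZ K m t n) i c d j (Fin.castLE hk)).det
      (chainExponent i c d j) := by
  classical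
  set ro := (Sum.elim (Sum.inl ∘ i) (Sum.elim (Sum.inr ∘ d) (Sum.inr ∘ Fin.castLE hk)) :
    Fin a ⊕ Fin b ⊕ Fin k → Fin m ⊕ Fin t) with hro
  set co := (Sum.elim (Sum.inr ∘ c) (Sum.elim (Sum.inl ∘ j) (Sum.inr ∘ Fin.castLE hk)) :
    Fin a ⊕ Fin b ⊕ Fin k → Fin n ⊕ Fin t) with hco
  have hcard : Fintype.card (Fin a ⊕ Fin b ⊕ Fin k) ≤ 3 * t := by
    have h1 : a ≤ t := by simpa using Fintype.card_le_of_injective c hc.injective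
    have h2 : b ≤ t := by simpa using Fintype.card_le_of_injective d hd.injective
    simp only [Fintype.card_sum, Fintype.card_fin]
    omega
  set E : Equiv.Perm (Fin a ⊕ Fin b ⊕ Fin k) → ((Fin m × Fin t) ⊕ (Fin t × Fin n) →₀ ℕ) :=
    fun σ => ∑ x, blockExponent (ro (σ x)) (co x) with hE
  set A : Equiv.Perm (Fin a ⊕ Fin b ⊕ Fin k) → K :=
    fun σ => (Equiv.Perm.sign σ : ℤ) * ∏ x, blockCoeff K (ro (σ x)) (co x) with hA
  have hdet : (mixedMatrix (matY K m t n) (matZ K m t n) i c d j (Fin.castLE hk)).det =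
      ∑ σ, monomial (E σ) (A σ) := by
    rw [Matrix.det_apply]
    refine Finset.sum_congr rfl fun σ _ => ?_
    have : ∀ x, mixedMatrix (matY K m t n) (matZ K m t n) i c d j (Fin.castLE hk) (σ x) x =
        monomial (blockExponent (ro (σ x)) (co x)) (blockCoeff K (ro (σ x)) (co x)) :=
      fun x => fromBlocks_eq_monomial K _ _
    simp only [this]
    rw [← monomial_sum_prod, Units.smul_def, zsmul_eq_mul, hA]
    rw [← C_mul_monomial, map_intCast]
  have hE1 : E 1 = chainExponent i c d j := by
    simp [hE, chainExponent, hro, hco, blockExponent, Fintype.sum_sum_type]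
  rw [hdet, ← hE1]
  have hwt : ∀ σ, Finsupp.weight (diagWeight m t n) (E σ) =
      weightFactor m t n * ∑ x, blockLinear (ro (σ x)) (co x) +
        ∑ x, blockQuadratic (ro (σ x)) (co x) := by
    intro σ
    simp only [hE, map_sum, weight_blockExponent, Finset.sum_add_distrib, Finset.mul_sum]
  refine hasLead_sum_monomial E A 1 ?_ ?_
  · simp [hA, hro, hco, blockCoeff, Fintype.prod_sum_type]
  intro σ hσ hAσ
  have hcoef : ∀ x, blockCoeff K (ro (σ x)) (co x) ≠ 0 := by
    intro x h0
    exact hAσ (by rw [hA]; simp only; rw [Finset.prod_eq_zero (Finset.mem_univ x) h0, mul_zero])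
  -- Dual variables of the assignment problem. Since `2 * k - 1` lies strictly between twice an
  -- index below `k` and twice an index at least `k`, nonzero entries outside the diagonal blocks
  -- are never tight; this is why the weights carry a factor `2`.
  set α : Fin a ⊕ Fin b ⊕ Fin k → ℤ := Sum.elim (fun _ => 2 * k - 1)
    (Sum.elim (fun l => 2 * (d l : ℕ) - (2 * k - 1)) fun _ => 0) with hα
  set β : Fin a ⊕ Fin b ⊕ Fin k → ℤ := Sum.elim (fun l => 2 * (c l : ℕ) - (2 * k - 1))
    (Sum.elim (fun _ => 2 * k - 1) fun _ => 0) with hβ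
  have hcell : ∀ x y, blockCoeff K (ro x) (co y) ≠ 0 →
      (blockLinear (ro x) (co y) : ℤ) ≤ α x + β y ∧
      ((blockLinear (ro x) (co y) : ℤ) = α x + β y →
        (∃ l l', y = Sum.inl l ∧ x = Sum.inl l') ∨
        (∃ l l', y = Sum.inr (Sum.inl l) ∧ x = Sum.inr (Sum.inl l')) ∨
        (∃ l, y = Sum.inr (Sum.inr l) ∧ x = Sum.inr (Sum.inr l))) := by
    intro x y
    rcases x with x | x | x <;> rcases y with y | y | y <;>
      simp only [hro, hco, hα, hβ, Sum.elim_inl, Sum.elim_inr, Function.comp, blockCoeff,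
        blockLinear, ne_eq, ite_eq_right_iff, one_ne_zero, not_true_eq_false, IsEmpty.forall_iff,
        imp_false, not_not, not_false_eq_true, forall_true_left]
    · refine ⟨by push_cast; omega, fun _ => Or.inl ⟨y, x, rfl, rfl⟩⟩
    · have := y.2
      have h9 : ((Fin.castLE hk y : Fin t) : ℕ) = y := rfl
      refine ⟨by push_cast; omega, fun h => ?_⟩
      push_cast at h; omega
    · intro hxy
      have h1 := hck y
      have h2 : (d x : ℕ) = c y := by rw [hxy]
      refine ⟨by push_cast; omega, fun h => ?_⟩
      push_cast at h; omega
    · refine ⟨by push_cast; omega, fun _ => Or.inr (Or.inl ⟨y, x, rfl, rfl⟩)⟩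
    · intro hxy
      have h1 := hdk x
      have h2 : (d x : ℕ) = y := by rw [hxy]; rfl
      have := y.2
      omega
    · intro hxy
      have h1 := hck y
      have h2 : (x : ℕ) = c y := by rw [← hxy]; rfl
      have := x.2
      omega
    · have := x.2
      have h9 : ((Fin.castLE hk x : Fin t) : ℕ) = x := rfl
      refine ⟨by push_cast; omega, fun h => ?_⟩
      push_cast at h; omega
    · intro hxy
      refine ⟨by simp, fun _ => Or.inr (Or.inr ⟨y, rfl, ?_⟩)⟩
      congr 2
      exact Fin.castLE_injective hk hxy
  have hone : ∑ x, (blockLinear (ro ((1 : Equiv.Perm (Fin a ⊕ Fin b ⊕ Fin k)) x)) (co x) : ℤ) = ∑ x, (α x + β x) := by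
    refine Finset.sum_congr rfl fun x _ => ?_
    rcases x with x | x | x <;> simp [hro, hco, hα, hβ, blockLinear]
  have hsumσ : ∑ x, (α (σ x) + β x) = ∑ x, (α x + β x) := by
    rw [Finset.sum_add_distrib, Finset.sum_add_distrib, Equiv.sum_comp σ α]
  rw [hwt, hwt]
  by_cases htight : ∀ x, (blockLinear (ro (σ x)) (co x) : ℤ) = α (σ x) + β x
  · have hL : ∑ x, blockLinear (ro (σ x)) (co x) =
        ∑ x, blockLinear (ro ((1 : Equiv.Perm (Fin a ⊕ Fin b ⊕ Fin k)) x)) (co x) := by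
      refine Nat.cast_injective (R := ℤ) ?_
      rw [Nat.cast_sum, Nat.cast_sum, hone, ← hsumσ]
      exact Finset.sum_congr rfl fun x _ => htight x
    rw [hL]
    refine Nat.add_lt_add_left ?_ _
    have hblk := fun x => (hcell (σ x) x (hcoef x)).2 (htight x)
    obtain ⟨s, hs⟩ := exists_perm_of_preserves σ Sum.inl Sum.inl_injective fun l => by
      rcases hblk (Sum.inl l) with ⟨x, y, _, h⟩ | ⟨x, y, h, _⟩ | ⟨x, h, _⟩
      · exact ⟨y, h⟩
      · simp at h
      · simp at h
    obtain ⟨s', hs'⟩ := exists_perm_of_preserves σ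
      (fun l => Sum.inr (Sum.inl l)) (Sum.inr_injective.comp Sum.inl_injective) fun l => by
      rcases hblk (Sum.inr (Sum.inl l)) with ⟨x, y, h, _⟩ | ⟨x, y, _, h⟩ | ⟨x, h, _⟩
      · simp at h
      · exact ⟨y, h⟩
      · simp at h
    have hs'' : ∀ l, σ (Sum.inr (Sum.inr l)) = Sum.inr (Sum.inr l) := by
      intro l
      rcases hblk (Sum.inr (Sum.inr l)) with ⟨x, y, h, _⟩ | ⟨x, y, h, _⟩ | ⟨x, h, h'⟩
      · simp at h
      · simp at h
      · rw [h']; exact h.symm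
    have hQ : ∑ x, blockQuadratic (ro (σ x)) (co x) =
        ∑ l, (i (s l) : ℕ) * (c l : ℕ) + ∑ l, (d (s' l) : ℕ) * (j l : ℕ) := by
      simp [Fintype.sum_sum_type, hs, hs', hs'', hro, hco, blockQuadratic]
    have hQ1 : ∑ x, blockQuadratic (ro ((1 : Equiv.Perm (Fin a ⊕ Fin b ⊕ Fin k)) x)) (co x) =
        ∑ l, (i l : ℕ) * (c l : ℕ) + ∑ l, (d l : ℕ) * (j l : ℕ) := by
      simp [Fintype.sum_sum_type, hro, hco, blockQuadratic]
    obtain ⟨h1, h1'⟩ := sum_perm_mul_lt (fun l => (i l : ℕ)) (fun l => (c l : ℕ)) hi hc s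
    obtain ⟨h2, h2'⟩ := sum_perm_mul_lt (fun l => (d l : ℕ)) (fun l => (j l : ℕ)) hd hj s'
    rw [hQ, hQ1]
    refine lt_of_le_of_ne (add_le_add h1 h2) fun heq => hσ ?_
    have e1 := h1' (by omega)
    have e2 := h2' (by omega)
    ext x
    rcases x with x | x | x
    · rw [hs, e1]; rfl
    · rw [hs', e2]; rfl
    · rw [hs'']; rfl
  · push Not at htight
    obtain ⟨x₀, hx₀⟩ := htight
    have hlt : ∑ x, blockLinear (ro (σ x)) (co x) <
        ∑ x, blockLinear (ro ((1 : Equiv.Perm (Fin a ⊕ Fin b ⊕ Fin k)) x)) (co x) := by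
      rw [← Nat.cast_lt (α := ℤ), Nat.cast_sum, Nat.cast_sum, hone, ← hsumσ]
      refine Finset.sum_lt_sum (fun x _ => (hcell (σ x) x (hcoef x)).1) ⟨x₀, Finset.mem_univ _, ?_⟩
      exact lt_of_le_of_ne (hcell (σ x₀) x₀ (hcoef x₀)).1 hx₀
    -- A loss of one in the dominant part outweighs any gain in the quadratic part.
    have hq := sum_blockQuadratic_lt hcard (fun x => ro (σ x)) co
    have := Nat.mul_le_mul_left (weightFactor m t n) (Nat.succ_le_of_lt hlt)
    rw [Nat.mul_succ] at this
    omega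

end MixedLead

/-! ### The leading monomial of the splitting polynomial. -/

section SplittingLead

open MvPolynomial

variable {m t n : ℕ}

theorem det_mixedMatrix_left {S : Type u} [CommRing S] (Y : Matrix (Fin m) (Fin t) S)
    (Z : Matrix (Fin t) (Fin n) S) {a : ℕ} (i : Fin a → Fin m) (c : Fin a → Fin t)
    (d : Fin 0 → Fin t) (j : Fin 0 → Fin n) (e : Fin 0 → Fin t) :
    (mixedMatrix Y Z i c d j e).det = (Y.submatrix i c).det := by
  rw [← Matrix.det_submatrix_equiv_self (Equiv.sumEmpty (Fin a) (Fin 0 ⊕ Fin 0)).symm]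
  rfl

theorem det_mixedMatrix_right {S : Type u} [CommRing S] (Y : Matrix (Fin m) (Fin t) S)
    (Z : Matrix (Fin t) (Fin n) S) {b : ℕ} (i : Fin 0 → Fin m) (c : Fin 0 → Fin t)
    (d : Fin b → Fin t) (j : Fin b → Fin n) (e : Fin 0 → Fin t) :
    (mixedMatrix Y Z i c d j e).det = (Z.submatrix d j).det := by
  rw [← Matrix.det_submatrix_equiv_self ((Equiv.sumEmpty (Fin b) (Fin 0)).symm.trans
    (Equiv.emptySum (Fin 0) (Fin b ⊕ Fin 0)).symm)]
  rfl

theorem hasLead_minorY (K : Type u) [Field K] {a : ℕ} (i : Fin a → Fin m) (c : Fin a → Fin t)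
    (hi : StrictMono i) (hc : StrictMono c) :
    HasLead (diagWeight m t n) ((matY K m t n).submatrix i c).det
      (∑ l, Finsupp.single (Sum.inl (i l, c l)) 1) := by
  have := hasLead_det_mixedMatrix (n := n) (k := 0) i c (Fin.elim0 : Fin 0 → Fin t)
    (Fin.elim0 : Fin 0 → Fin n) (Nat.zero_le t) K hi hc (fun l => l.elim0) (fun l => l.elim0)
    (fun _ => Nat.zero_le _) (fun _ => Nat.zero_le _)
  rw [det_mixedMatrix_left] at this
  simpa [chainExponent] using this

theorem hasLead_minorZ (K : Type u) [Field K] {b : ℕ} (d : Fin b → Fin t) (j : Fin b → Fin n)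
    (hd : StrictMono d) (hj : StrictMono j) :
    HasLead (diagWeight m t n) ((matZ K m t n).submatrix d j).det
      (∑ l, Finsupp.single (Sum.inr (d l, j l)) 1) := by
  have := hasLead_det_mixedMatrix (m := m) (k := 0) (Fin.elim0 : Fin 0 → Fin m)
    (Fin.elim0 : Fin 0 → Fin t) d j (Nat.zero_le t) K (fun l => l.elim0) (fun l => l.elim0)
    hd hj (fun _ => Nat.zero_le _) (fun _ => Nat.zero_le _)
  rw [det_mixedMatrix_right] at this
  simpa [chainExponent] using this

/-- The cell `(i, c)` with `c ≤ i` occurs only on the diagonal that starts in row `i - c`, at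
position `c`. -/
theorem sum_diag_lower {τ : Type*} (v : Fin m → Fin t → τ)
    (hv : Function.Injective2 v) (i : Fin m) (c : Fin t) :
    (∑ d : Fin m, ∑ l : Fin (min t (m - d)),
      (Finsupp.single (v ⟨d + l, by omega⟩ (Fin.castLE (min_le_left _ _) l)) 1 : τ →₀ ℕ))
        (v i c) = if (c : ℕ) ≤ i then 1 else 0 := by
  classical
  simp only [Finsupp.finsetSum_apply, Finsupp.single_apply, hv.eq_iff, Fin.ext_iff,
    Fin.val_castLE]
  split_ifs with h
  · rw [Fintype.sum_eq_single ⟨i - c, by omega⟩, Fintype.sum_eq_single ⟨c, by simp; omega⟩,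
      if_pos]
    · simp; omega
    · intro l hl
      rw [if_neg]
      rintro ⟨_, h2⟩
      exact hl (Fin.ext h2)
    · intro d hd
      refine Finset.sum_eq_zero fun l _ => if_neg ?_
      rintro ⟨h1, h2⟩
      exact hd (Fin.ext (by simp; omega))
  · refine Finset.sum_eq_zero fun d _ => Finset.sum_eq_zero fun l _ => if_neg ?_
    rintro ⟨h1, h2⟩
    omega

/-- The cell `(i, c)` with `i < c` occurs only on the diagonal of length `t - (c - i)`, at position
`i`. -/
theorem sum_diag_upper {τ : Type*} (hm : t ≤ m) (v : Fin m → Fin t → τ)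
    (hv : Function.Injective2 v) (i : Fin m) (c : Fin t) :
    (∑ k : Fin t, ∑ l : Fin k,
      (Finsupp.single (v (Fin.castLE (k.2.le.trans hm) l) ⟨t - k + l, by omega⟩) 1 : τ →₀ ℕ))
        (v i c) = if (c : ℕ) ≤ i then 0 else 1 := by
  classical
  simp only [Finsupp.finsetSum_apply, Finsupp.single_apply, hv.eq_iff, Fin.ext_iff,
    Fin.val_castLE]
  split_ifs with h
  · refine Finset.sum_eq_zero fun d _ => Finset.sum_eq_zero fun l _ => if_neg ?_
    rintro ⟨h1, h2⟩
    omega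
  · rw [Fintype.sum_eq_single ⟨t - (c - i), by omega⟩,
      Fintype.sum_eq_single ⟨i, by simp; omega⟩, if_pos]
    · simp; omega
    · intro l hl
      rw [if_neg]
      rintro ⟨h2, _⟩
      exact hl (Fin.ext h2)
    · intro d hd
      refine Finset.sum_eq_zero fun l _ => if_neg ?_
      rintro ⟨h1, h2⟩
      exact hd (Fin.ext (by simp; omega))

/-- Leading exponents add up, and the two families of diagonals partition the cells of `Y`, and
after transposition those of `Z`. -/
theorem hasLead_splittingPoly (K : Type u) [Field K] (hm : t ≤ m) (hn : t ≤ n) :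
    HasLead (diagWeight m t n) (splittingPoly hm hn (matY K m t n) (matZ K m t n))
      (Finsupp.equivFunOnFinite.symm fun _ => 1) := by
  have h1 := HasLead.prod Finset.univ (diagMinorY (matY K m t n)) _ fun d _ =>
    hasLead_minorY (n := n) K (fun l : Fin (min t (m - d)) => (⟨d + l, by omega⟩ : Fin m))
      (Fin.castLE (min_le_left _ _)) (fun l l' h => by simpa using h)
      (Fin.strictMono_castLE _)
  have h2 := HasLead.prod Finset.univ (diagMinorZ (matZ K m t n)) _ fun d _ =>
    hasLead_minorZ (m := m) K (Fin.castLE (min_le_left _ _))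
      (fun l : Fin (min t (n - d)) => (⟨d + l, by omega⟩ : Fin n))
      (Fin.strictMono_castLE _) (fun l l' h => by simpa using h)
  have h3 := HasLead.prod Finset.univ (productMinor hm hn (matY K m t n) (matZ K m t n)) _
    fun k _ => hasLead_det_mixedMatrix (Fin.castLE (k.2.le.trans hm))
      (fun l : Fin k => (⟨t - k + l, by omega⟩ : Fin t))
      (fun l : Fin k => (⟨t - k + l, by omega⟩ : Fin t)) (Fin.castLE (k.2.le.trans hn))
      (Nat.sub_le t k) K (Fin.strictMono_castLE _) (fun l l' h => by simpa using h)
      (fun l l' h => by simpa using h) (Fin.strictMono_castLE _) (fun l => by simp)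
      (fun l => by simp)
  refine (congrArg (HasLead _ _) ?_ : _ = _).mp ((h1.mul h2).mul h3)
  simp only [chainExponent, Finset.sum_add_distrib]
  ext (⟨i, c⟩ | ⟨c, j⟩)
  · have e1 := sum_diag_lower (fun (i : Fin m) (c : Fin t) =>
      (Sum.inl (i, c) : (Fin m × Fin t) ⊕ (Fin t × Fin n)))
      (fun _ _ _ _ h => by simpa using h) i c
    have e2 := sum_diag_upper hm (fun (i : Fin m) (c : Fin t) =>
      (Sum.inl (i, c) : (Fin m × Fin t) ⊕ (Fin t × Fin n)))
      (fun _ _ _ _ h => by simpa using h) i c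
    simp only [Finsupp.add_apply, e1, e2]
    simp only [Finsupp.finsetSum_apply, Finsupp.single_apply, reduceCtorEq, if_false,
      Finset.sum_const_zero, Finsupp.coe_equivFunOnFinite_symm]
    split_ifs <;> rfl
  · have e1 := sum_diag_lower (fun (j : Fin n) (c : Fin t) =>
      (Sum.inr (c, j) : (Fin m × Fin t) ⊕ (Fin t × Fin n)))
      (fun _ _ _ _ h => by simpa [and_comm] using h) j c
    have e2 := sum_diag_upper hn (fun (j : Fin n) (c : Fin t) =>
      (Sum.inr (c, j) : (Fin m × Fin t) ⊕ (Fin t × Fin n)))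
      (fun _ _ _ _ h => by simpa [and_comm] using h) j c
    simp only [Finsupp.add_apply, e1, e2]
    simp only [Finsupp.finsetSum_apply, Finsupp.single_apply, reduceCtorEq, if_false,
      Finset.sum_const_zero, Finsupp.coe_equivFunOnFinite_symm]
    split_ifs <;> rfl

end SplittingLead

/-! ### The splitting and its compatibility with the strata. -/

section Splitting

open MvPolynomial

/-- The leading exponent of `f ^ (p - 1)` is constantly `p - 1`, which contributes `φ 1 = 1`. Any
other exponent seen by the trace is this one plus `p • e`, whose weight is not smaller, so it cannot
occur. -/
theorem frobTrace_pow_eq_one {K : Type u} [Field K] {σ : Type v} [Fintype σ] (p : ℕ)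
    [hp : Fact p.Prime] (φ : K →+ K) (hφ : φ 1 = 1) (w : σ → ℕ) (f : MvPolynomial σ K)
    (hf : HasLead w f (Finsupp.equivFunOnFinite.symm fun _ => 1)) :
    frobTrace p φ (f ^ (p - 1)) = 1 := by
  classical
  have hl := hf.pow (p - 1)
  have hsm : (p - 1) • (Finsupp.equivFunOnFinite.symm fun _ => 1 : σ →₀ ℕ) =
      Finsupp.equivFunOnFinite.symm fun _ => p - 1 := by
    ext; simp
  rw [hsm] at hl
  ext e
  rw [coeff_frobTrace, coeff_one]
  split_ifs with he
  · subst he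
    rw [smul_zero, add_zero, hl.1, hφ]
  · by_cases h0 : coeff (Finsupp.equivFunOnFinite.symm (fun _ => p - 1) + p • e)
        (f ^ (p - 1)) = 0
    · rw [h0, map_zero]
    · have := hl.2 _ h0 (by
        intro h
        rw [add_eq_left, smul_eq_zero] at h
        exact h.elim hp.out.ne_zero (Ne.symm he))
      rw [map_add] at this
      omega

variable {K : Type u} [Field K] (p : ℕ) [hp : Fact p.Prime] (φ : K →+ K) {m t n : ℕ}

/-- The splitting of Frobenius on `K[Y, Z]`. -/
noncomputable def complexSplitting (hm : t ≤ m) (hn : t ≤ n) :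
    PolyYZ K m t n →+ PolyYZ K m t n :=
  (frobTrace p φ).comp
    (AddMonoidHom.mulLeft (splittingPoly hm hn (matY K m t n) (matZ K m t n) ^ (p - 1)))

variable [CharP K p]

theorem isFrobeniusSplitting_complexSplitting (hφ1 : φ 1 = 1)
    (hφ : ∀ a b, φ (a ^ p * b) = a * φ b) (hm : t ≤ m) (hn : t ≤ n) :
    IsFrobeniusSplitting p (complexSplitting p φ hm hn : PolyYZ K m t n →+ PolyYZ K m t n) := by
  have h1 := frobTrace_pow_eq_one p φ hφ1 _ _ (hasLead_splittingPoly K hm hn)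
  constructor
  · intro a b
    simp only [complexSplitting, AddMonoidHom.comp_apply, AddMonoidHom.coe_mulLeft, frobenius_def]
    rw [mul_left_comm, frobTrace_pow_mul p φ hφ]
  · intro a
    simp only [complexSplitting, AddMonoidHom.comp_apply, AddMonoidHom.coe_mulLeft, frobenius_def]
    rw [mul_comm, frobTrace_pow_mul p φ hφ, h1, mul_one]

theorem isCompatiblySplit_rankGens (hφ : ∀ a b, φ (a ^ p * b) = a * φ b) (hm : t ≤ m)
    (hn : t ≤ n) {r : ℕ} (R : Fin r ↪ Fin m) (C : Fin r ↪ Fin t) :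
    IsCompatiblySplit (complexSplitting p φ hm hn)
      ((Ideal.span (Set.range (rankGens (matY K m t n) R C))).saturationBy
        ((matY K m t n).submatrix R C).det) := by
  obtain ⟨M, hM⟩ := vanishesToOrder_splittingPoly_rankGens (matY K m t n) (matZ K m t n) R C hm hn
  rw [← card_rankGens R C] at hM
  exact isCompatiblySplit_saturationBy _ _ _ p hp.out.pos (frobTrace p φ) _
    (frobTrace_pow_mul p φ hφ) (fun g => rfl) M hM

theorem isCompatiblySplit_nullconeGens (hφ : ∀ a b, φ (a ^ p * b) = a * φ b) (hm : t ≤ m)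
    (hn : t ≤ n) {r : ℕ} (R : Fin r ↪ Fin m) (C : Fin r ↪ Fin t) :
    IsCompatiblySplit (complexSplitting p φ hm hn)
      ((Ideal.span (Set.range (nullconeGens (matY K m t n) (matZ K m t n) R C))).saturationBy
        ((matY K m t n).submatrix R C).det) := by
  obtain ⟨M, hM⟩ :=
    vanishesToOrder_splittingPoly_nullconeGens (matY K m t n) (matZ K m t n) R C hm hn
  have hcard : Fintype.card (((Set.range R)ᶜ : Set (Fin m)) × ((Set.range C)ᶜ : Set (Fin t)) ⊕
      Fin r × Fin n) = (m - r) * (t - r) + r * n := by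
    rw [Fintype.card_sum, card_rankGens, Fintype.card_prod, Fintype.card_fin, Fintype.card_fin]
  rw [← hcard] at hM
  exact isCompatiblySplit_saturationBy _ _ _ p hp.out.pos (frobTrace p φ) _
    (frobTrace_pow_mul p φ hφ) (fun g => rfl) M hM

end Splitting

/-! ### Chains of cells and colourings by antichains. -/

section Chains

variable {t N : ℕ}

/-- The cells satisfying `F` contain a chain of length `a`, strictly increasing in both
coordinates, with first coordinates at least `k`. -/
def HasChain (F : Fin t → Fin N → Prop) (k a : ℕ) : Prop :=
  ∃ (c : Fin a → Fin t) (i : Fin a → Fin N), StrictMono c ∧ StrictMono i ∧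
    (∀ l, F (c l) (i l)) ∧ ∀ l, k ≤ (c l : ℕ)

open Classical in
/-- The largest length of a chain of cells satisfying `F` with first coordinates at least `k`. -/
noncomputable def maxChainLength (F : Fin t → Fin N → Prop) (k : ℕ) : ℕ :=
  Nat.findGreatest (HasChain F k) t

variable {F : Fin t → Fin N → Prop} {k a : ℕ}

theorem hasChain_zero : HasChain F k 0 :=
  ⟨Fin.elim0, Fin.elim0, fun l => l.elim0, fun l => l.elim0, fun l => l.elim0, fun l => l.elim0⟩

theorem HasChain.le (h : HasChain F k a) : a ≤ t - k := by
  obtain ⟨c, i, hc, -, -, hk⟩ := h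
  have hle : ∀ b, ∀ hb : b < a, k + b ≤ (c ⟨b, hb⟩ : ℕ) := by
    intro b
    induction b with
    | zero => intro hb; simpa using hk ⟨0, hb⟩
    | succ b ih =>
      intro hb
      have h1 := ih (by omega)
      have h2 : c ⟨b, by omega⟩ < c ⟨b + 1, hb⟩ := hc (by simp)
      have := Fin.lt_def.1 h2
      omega
  rcases Nat.eq_zero_or_pos a with rfl | ha
  · omega
  · have h1 := hle (a - 1) (by omega)
    have h2 := (c ⟨a - 1, by omega⟩).2
    omega

theorem hasChain_maxChainLength : HasChain F k (maxChainLength F k) := by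
  classical
  exact Nat.findGreatest_spec (P := HasChain F k) (Nat.zero_le t) hasChain_zero

theorem HasChain.le_maxChainLength (h : HasChain F k a) : a ≤ maxChainLength F k := by
  classical
  exact Nat.le_findGreatest (h.le.trans (Nat.sub_le _ _)) h

theorem HasChain.mono {a' : ℕ} (h : HasChain F k a) (ha : a' ≤ a) : HasChain F k a' := by
  obtain ⟨c, i, hc, hi, hF, hk⟩ := h
  exact ⟨c ∘ Fin.castLE ha, i ∘ Fin.castLE ha, hc.comp (Fin.strictMono_castLE ha),
    hi.comp (Fin.strictMono_castLE ha), fun l => hF _, fun l => hk _⟩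

theorem maxChainLength_le : maxChainLength F k ≤ t - k := hasChain_maxChainLength.le

theorem maxChainLength_succ_le : maxChainLength F (k + 1) ≤ maxChainLength F k := by
  obtain ⟨c, i, hc, hi, hF, hk⟩ := hasChain_maxChainLength (F := F) (k := k + 1)
  exact HasChain.le_maxChainLength ⟨c, i, hc, hi, hF, fun l => (Nat.le_succ k).trans (hk l)⟩

/-- Remove the first cell of a longest chain. -/
theorem maxChainLength_le_succ : maxChainLength F k ≤ maxChainLength F (k + 1) + 1 := by
  rcases Nat.eq_zero_or_pos (maxChainLength F k) with h0 | h0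
  · omega
  obtain ⟨b, hb⟩ : ∃ b, maxChainLength F k = b + 1 := ⟨maxChainLength F k - 1, by omega⟩
  have h := hasChain_maxChainLength (F := F) (k := k)
  rw [hb] at h ⊢
  obtain ⟨c, i, hc, hi, hF, hk⟩ := h
  refine Nat.succ_le_succ (HasChain.le_maxChainLength ⟨c ∘ Fin.succ, i ∘ Fin.succ,
    hc.comp Fin.strictMono_succ, hi.comp Fin.strictMono_succ, fun l => hF _, fun l => ?_⟩)
  have h1 : c 0 < c l.succ := hc (Fin.succ_pos l)
  have := hk 0
  have := Fin.lt_def.1 h1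
  simp only [Function.comp]
  omega

/-- Chains can be extended by a smaller cell. -/
theorem hasChain_cons {F' : Fin t → Fin N → Prop} {c₀ : Fin t} {i₀ : Fin N} (h₀ : F c₀ i₀)
    (hk : k ≤ (c₀ : ℕ)) (hF' : ∀ c i, F' c i → F c i ∧ c₀ < c ∧ i₀ < i) {k' : ℕ}
    (h : HasChain F' k' a) : HasChain F k (a + 1) := by
  obtain ⟨c, i, hc, hi, hF, -⟩ := h
  refine ⟨Fin.cons c₀ c, Fin.cons i₀ i, ?_, ?_, ?_, ?_⟩
  · intro l l'
    refine Fin.cases ?_ (fun l => ?_) l <;> refine Fin.cases ?_ (fun l' => ?_) l' <;> intro hl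
    · simp at hl
    · simpa using (hF' _ _ (hF l')).2.1
    · simp at hl
    · simpa using hc (by simpa using hl)
  · intro l l'
    refine Fin.cases ?_ (fun l => ?_) l <;> refine Fin.cases ?_ (fun l' => ?_) l' <;> intro hl
    · simp at hl
    · simpa using (hF' _ _ (hF l')).2.2
    · simp at hl
    · simpa using hi (by simpa using hl)
  · intro l
    refine Fin.cases ?_ (fun l => ?_) l
    · simpa using h₀
    · simpa using (hF' _ _ (hF l)).1
  · intro l
    refine Fin.cases ?_ (fun l => ?_) l
    · simpa using hk
    · have := Fin.lt_def.1 (hF' _ _ (hF l)).2.1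
      simp only [Fin.cons_succ]
      omega

/-- Cells can be ranked so that the rank drops along chains. -/
theorem exists_chain_rank (F : Fin t → Fin N → Prop) : ∃ h : Fin t → Fin N → ℕ,
    (∀ c i, F c i → h c i < maxChainLength F c) ∧
    ∀ c i c' i', F c' i' → c < c' → i < i' → h c' i' < h c i := by
  -- The rank is the greatest length of a chain strictly beyond the cell in both coordinates.
  refine ⟨fun c i => maxChainLength (fun c' i' => F c' i' ∧ c < c' ∧ i < i') 0, ?_, ?_⟩
  · intro c i hF
    exact Nat.lt_of_succ_le (HasChain.le_maxChainLength
      (hasChain_cons hF le_rfl (fun _ _ h => h) hasChain_maxChainLength))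
  · intro c i c' i' hF hc hi
    refine Nat.lt_of_succ_le (HasChain.le_maxChainLength (hasChain_cons ⟨hF, hc, hi⟩ (Nat.zero_le _)
      (fun c'' i'' h => ⟨⟨h.1, hc.trans h.2.1, hi.trans h.2.2⟩, h.2⟩) hasChain_maxChainLength))

/-- The number of elements of `O` that are at least `k`. -/
def countGE (O : Finset (Fin t)) (k : ℕ) : ℕ := (O.filter fun c : Fin t => k ≤ (c : ℕ)).card

theorem countGE_of_le (O : Finset (Fin t)) (hk : t ≤ k) : countGE O k = 0 := by
  rw [countGE, Finset.card_eq_zero, Finset.filter_eq_empty_iff]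
  intro c _
  have := c.2
  omega

theorem countGE_eq (O : Finset (Fin t)) (hk : k < t) :
    countGE O k = countGE O (k + 1) + if (⟨k, hk⟩ : Fin t) ∈ O then 1 else 0 := by
  classical
  have h1 : O.filter (fun c : Fin t => k ≤ (c : ℕ)) =
      O.filter (fun c : Fin t => k + 1 ≤ (c : ℕ)) ∪ O.filter (fun c : Fin t => c = ⟨k, hk⟩) := by
    ext c
    simp only [Finset.mem_filter, Finset.mem_union, Fin.ext_iff]
    have : k ≤ (c : ℕ) ↔ k + 1 ≤ (c : ℕ) ∨ (c : ℕ) = k := by omega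
    rw [this]; tauto
  rw [countGE, h1, Finset.card_union_of_disjoint, Finset.filter_eq']
  · split_ifs <;> simp [countGE]
  · rw [Finset.disjoint_left]
    intro c hc hc'
    have h2 := (Finset.mem_filter.1 hc).2
    have h3 := (Finset.mem_filter.1 hc').2
    rw [h3] at h2
    simp at h2

theorem countGE_add_compl (O : Finset (Fin t)) (hk : k ≤ t) :
    countGE O k + countGE Oᶜ k = t - k := by
  induction hd : t - k generalizing k with
  | zero =>
    rw [countGE_of_le _ (by omega), countGE_of_le _ (by omega)]
  | succ d ih =>
    have hk' : k < t := by omega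
    rw [countGE_eq O hk', countGE_eq Oᶜ hk']
    have := ih (k := k + 1) (by omega) (by omega)
    simp only [Finset.mem_compl]
    split_ifs <;> omega

/-- If `O` has enough large elements, the cells can be coloured by `O` so that colours are
antichains lying weakly below their colour. -/
theorem exists_chain_colouring (F : Fin t → Fin N → Prop) (O : Finset (Fin t))
    (hO : ∀ k, maxChainLength F k ≤ countGE O k) : ∃ κ : Fin t → Fin N → Fin t,
      (∀ c i, F c i → κ c i ∈ O ∧ c ≤ κ c i) ∧
      ∀ c i c' i', F c i → F c' i' → c < c' → i < i' → κ c i ≠ κ c' i' := by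
  obtain ⟨h, h1, h2⟩ := exists_chain_rank F
  have key : ∀ c i, ∃ x : Fin t, F c i → x ∈ O ∧ c ≤ x ∧ countGE O x = h c i + 1 := by
    intro c i
    by_cases hF : F c i
    · have hc : h c i + 1 ≤ countGE O c := (Nat.succ_le_of_lt (h1 c i hF)).trans (hO c)
      -- `x` is the `(h c i + 1)`-st largest element of `O`, and `hO` places it at or beyond `c`.
      -- Comparable cells have different ranks, hence different colours.
      set x := Nat.findGreatest (fun k => h c i + 1 ≤ countGE O k) t with hx
      have hcx : (c : ℕ) ≤ x := Nat.le_findGreatest c.2.le hc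
      have hxs : h c i + 1 ≤ countGE O x :=
        Nat.findGreatest_spec (P := fun k => h c i + 1 ≤ countGE O k) c.2.le hc
      have hxt : x < t := by
        by_contra hlt
        rw [countGE_of_le O (by omega)] at hxs
        omega
      have hx1 : ¬ h c i + 1 ≤ countGE O (x + 1) :=
        Nat.findGreatest_is_greatest (P := fun k => h c i + 1 ≤ countGE O k)
          (Nat.lt_succ_self x) hxt
      have hstep := countGE_eq O hxt
      refine ⟨⟨x, hxt⟩, fun _ => ?_⟩
      split_ifs at hstep with hmem
      · exact ⟨hmem, hcx, by change countGE O x = _; omega⟩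
      · omega
    · exact ⟨c, fun hF' => absurd hF' hF⟩
  choose κ hκ using key
  refine ⟨κ, fun c i hF => ⟨(hκ c i hF).1, (hκ c i hF).2.1⟩, ?_⟩
  intro c i c' i' hF hF' hc hi heq
  have e1 := (hκ c i hF).2.2
  have e2 := (hκ c' i' hF').2.2
  have e3 := h2 c i c' i' hF' hc hi
  rw [heq] at e1
  omega

/-- The positions where `maxChainLength` drops. -/
theorem exists_countGE_eq_maxChainLength (F : Fin t → Fin N → Prop) :
    ∃ D : Finset (Fin t), ∀ k, countGE D k = maxChainLength F k := by
  classical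
  -- The chain length drops by zero or one when `k` increases by one, and it vanishes at `t`; so it
  -- counts the positions of its drops.
  refine ⟨Finset.univ.filter fun c => maxChainLength F (c + 1) < maxChainLength F c, fun k => ?_⟩
  set D : Finset (Fin t) := Finset.univ.filter fun c => maxChainLength F (c + 1) < maxChainLength F c with hD
  induction hd : t - k generalizing k with
  | zero =>
    have := maxChainLength_le (F := F) (k := k)
    rw [countGE_of_le _ (by omega)]
    omega
  | succ d ih =>
    have hk : k < t := by omega
    rw [countGE_eq _ hk, ih (k + 1) (by omega)]
    have h1 := maxChainLength_succ_le (F := F) (k := k)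
    have h2 := maxChainLength_le_succ (F := F) (k := k)
    have h3 : (⟨k, hk⟩ : Fin t) ∈ D ↔ maxChainLength F (k + 1) < maxChainLength F k := by simp [hD]
    split_ifs with h <;> rw [h3] at h <;> omega

end Chains

/-! ### Potentials for Monge weights. -/

section Potentials

variable {Γ : Type*} [AddCommGroup Γ] [LinearOrder Γ] [IsOrderedAddMonoid Γ] {t N : ℕ}

/-- Dual variables that are tight on an antichain, for weights satisfying the Monge condition. -/
theorem exists_potentials (w : Fin t → Fin N → Γ) (hN : 0 < N)
    (hw : ∀ c c' i i', c < c' → i < i' → w c i + w c' i' < w c i' + w c' i)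
    (P : Fin t → Fin N → Prop)
    (hP : ∀ c c' i i', c < c' → i < i' → P c i → P c' i' → False) :
    ∃ (α : Fin N → Γ) (β : Fin t → Γ), (∀ c i, w c i ≤ α i + β c) ∧
      (∀ c, ∃ i, w c i = α i + β c) ∧ ∀ c i, P c i → w c i = α i + β c := by
  classical
  rcases Nat.eq_zero_or_pos t with rfl | ht
  · exact ⟨0, 0, fun c => c.elim0, fun c => c.elim0, fun c => c.elim0⟩
  -- `P` is a staircase: `f k` lies weakly below the first coordinates of its cells with `i ≤ k` and
  -- weakly above those of its cells with `i > k`. The value `last` serves when no cell has `i ≤ k`.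
  let last : Fin t := ⟨t - 1, by omega⟩
  have hne : ∀ k : ℕ, (insert last (Finset.univ.filter fun c : Fin t =>
      ∃ i : Fin N, (i : ℕ) ≤ k ∧ P c i)).Nonempty := fun k => Finset.insert_nonempty _ _
  let f : ℕ → Fin t := fun k => Finset.min' _ (hne k)
  have hf1 : ∀ c i, P c i → ∀ k : ℕ, (i : ℕ) ≤ k → f k ≤ c := fun c i h k hk =>
    Finset.min'_le _ _ (Finset.mem_insert_of_mem
      (Finset.mem_filter.2 ⟨Finset.mem_univ _, i, hk, h⟩))
  have hf2 : ∀ c i, P c i → ∀ k : ℕ, k < (i : ℕ) → c ≤ f k := by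
    intro c i h k hk
    refine Finset.le_min' _ _ _ fun c' hc' => ?_
    rcases Finset.mem_insert.1 hc' with rfl | hc'
    · exact Fin.le_def.2 (by simp only [last]; omega)
    · obtain ⟨-, i', hi', hP'⟩ := Finset.mem_filter.1 hc'
      by_contra! hlt
      exact hP c' c i' i hlt (Fin.lt_def.2 (by omega)) hP' h
  let W : Fin t → ℕ → Γ := fun c k => if h : k < N then w c ⟨k, h⟩ else 0
  have hW : ∀ c (i : Fin N), W c i = w c i := fun c i => by simp [W]
  -- By the Monge condition, the increments of `w c` decrease as `c` grows.
  have hmono : ∀ c c' k, c ≤ c' → k + 1 < N →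
      W c' (k + 1) - W c' k ≤ W c (k + 1) - W c k := by
    intro c c' k hc hk
    rcases hc.eq_or_lt with rfl | hc
    · exact le_rfl
    · have h1 := hw c c' ⟨k, by omega⟩ ⟨k + 1, hk⟩ hc (by simp)
      have e : ∀ c, W c (k + 1) = w c ⟨k + 1, hk⟩ := fun c => by simp [W, hk]
      have e' : ∀ c, W c k = w c ⟨k, by omega⟩ := fun c => by
        simp only [W]; rw [dif_pos (by omega)]
      rw [e, e, e', e', sub_le_sub_iff]
      rw [add_comm (w c' _) , add_comm (w c _) (w c' _)]
      rw [add_comm (w c' _) (w c _)]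
      exact h1.le
  -- The increments of `α` follow the staircase. For a cell `(c, i)` of `P` those of `w c` are at
  -- least as large before `i` and at most as large from `i` on, so `w c - α` is maximal at `i`.
  let α : ℕ → Γ := fun i => ∑ k ∈ Finset.range i, (W (f k) (k + 1) - W (f k) k)
  have htel : ∀ c i i', i ≤ i' → W c i' - W c i = ∑ k ∈ Finset.Ico i i', (W c (k + 1) - W c k) :=
    fun c i i' h => (Finset.sum_Ico_sub (W c) h).symm
  have hαd : ∀ i i', i ≤ i' →
      α i' - α i = ∑ k ∈ Finset.Ico i i', (W (f k) (k + 1) - W (f k) k) :=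
    fun i i' h => (Finset.sum_Ico_eq_sub _ h).symm
  have hbest : ∀ c (i i' : Fin N), P c i → w c i' - α i' ≤ w c i - α i := by
    intro c i i' h
    rw [← hW, ← hW]
    rcases le_or_gt i i' with hle | hlt
    · have : W c i' - W c i ≤ α i' - α i := by
        rw [htel c i i' hle, hαd i i' hle]
        refine Finset.sum_le_sum fun k hk => ?_
        obtain ⟨hk1, hk2⟩ := Finset.mem_Ico.1 hk
        exact hmono _ _ _ (hf1 c i h k hk1) (by omega)
      rw [sub_le_sub_iff] at this ⊢
      rwa [add_comm (α i')] at this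
    · have : α i - α i' ≤ W c i - W c i' := by
        have hle : (i' : ℕ) ≤ i := hlt.le
        rw [htel c i' i hle, hαd i' i hle]
        refine Finset.sum_le_sum fun k hk => ?_
        obtain ⟨hk1, hk2⟩ := Finset.mem_Ico.1 hk
        exact hmono _ _ _ (hf2 c i h k hk2) (by omega)
      rw [sub_le_sub_iff] at this ⊢
      rw [add_comm]
      rwa [add_comm (W c i)] at this ⊢
  have hne' : (Finset.univ : Finset (Fin N)).Nonempty := ⟨⟨0, hN⟩, Finset.mem_univ _⟩
  refine ⟨fun i => α i, fun c => Finset.univ.sup' hne' fun i => w c i - α i, ?_, ?_, ?_⟩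
  · intro c i
    rw [← sub_le_iff_le_add']
    exact Finset.le_sup' (fun i : Fin N => w c i - α i) (Finset.mem_univ i)
  · intro c
    obtain ⟨i, -, hi⟩ := Finset.exists_mem_eq_sup' hne' fun i : Fin N => w c i - α i
    exact ⟨i, by simp only [hi, add_sub_cancel]⟩
  · intro c i h
    have : Finset.univ.sup' hne' (fun i : Fin N => w c i - α i) = w c i - α i :=
      le_antisymm (Finset.sup'_le _ _ fun i' _ => hbest c i i' h)
        (Finset.le_sup' (fun i : Fin N => w c i - α i) (Finset.mem_univ i))
    simp only [this, add_sub_cancel]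

end Potentials

/-! ### Points over Hahn series with prescribed valuations. -/

section ValuedPoints

open HahnSeries

variable {Γ : Type w} [AddCommGroup Γ] [LinearOrder Γ] [IsOrderedAddMonoid Γ] {A : Type u} [Field A]

theorem addVal_single_one (γ : Γ) : addVal Γ A (single γ (1 : A)) = γ := by
  rw [addVal_apply, orderTop_single one_ne_zero]

/-- Generic linear combinations have the expected valuation. -/
theorem addVal_sum_generic {ι : Type*} (O : Finset ι) (x : ι → A)
    (hx : ∀ s ⊆ O, s.Nonempty → ∑ κ ∈ s, x κ ≠ 0) (z : ι → HahnSeries Γ A) (g : Γ)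
    (hz : ∀ κ ∈ O, (∃ γ, g ≤ γ ∧ z κ = single γ 1) ∨ (g : WithTop Γ) < addVal Γ A (z κ)) :
    (g : WithTop Γ) ≤ addVal Γ A (∑ κ ∈ O, C (x κ) * z κ) ∧
      ((∃ κ ∈ O, z κ = single g 1) → addVal Γ A (∑ κ ∈ O, C (x κ) * z κ) = g) := by
  classical
  have hge : (g : WithTop Γ) ≤ addVal Γ A (∑ κ ∈ O, C (x κ) * z κ) := by
    refine AddValuation.map_le_sum _ fun κ hκ => ?_
    have hxκ : x κ ≠ 0 := by
      simpa using hx {κ} (by simpa using hκ) (Finset.singleton_nonempty _)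
    rw [AddValuation.map_mul, C_apply, addVal_apply, orderTop_single hxκ]
    rw [WithTop.coe_zero, zero_add]
    rcases hz κ hκ with ⟨γ, hγ, h⟩ | h
    · rw [h, addVal_single_one]
      exact_mod_cast hγ
    · exact h.le
  refine ⟨hge, ?_⟩
  rintro ⟨κ₀, hκ₀, h₀⟩
  refine le_antisymm (addVal_le_of_coeff_ne_zero ?_) hge
  -- The coefficient at `g` is a nonempty subset sum of the `x κ`, so the leading terms cannot
  -- cancel.
  have hcoeff : (∑ κ ∈ O, C (x κ) * z κ).coeff g =
      ∑ κ ∈ O.filter (fun κ => z κ = single g 1), x κ := by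
    rw [coeff_sum, Finset.sum_filter]
    refine Finset.sum_congr rfl fun κ hκ => ?_
    rw [C_mul_eq_smul, coeff_smul, smul_eq_mul]
    split_ifs with h
    · rw [h, coeff_single_same, mul_one]
    · rcases hz κ hκ with ⟨γ, hγ, h'⟩ | h'
      · have : g ≠ γ := by
          rintro rfl
          exact h h'
        rw [h', coeff_single_of_ne this, mul_zero]
      · rw [coeff_eq_zero_of_lt_orderTop (by rwa [addVal_apply] at h'), mul_zero]
  rw [hcoeff]
  exact hx _ (Finset.filter_subset _ _) ⟨κ₀, Finset.mem_filter.2 ⟨hκ₀, h₀⟩⟩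

variable {t : ℕ}

/-- A vector with prescribed entries up to position `κ`, continued so as to be orthogonal to
vectors with prescribed entries at positions outside `O`. -/
noncomputable def kernelVec (A : Type u) [Field A] (O : Finset (Fin t)) (β : Fin t → Γ)
    (π : Fin t → Fin t → Γ) (κ : Fin t) (c : Fin t) : HahnSeries Γ A :=
  if c ≤ κ then single (β c) 1
  else if c ∈ O then 0
  else -∑ c' : {c' // c' < c}, kernelVec A O β π κ c'.1 * single (π c c'.1 - π c c) 1
termination_by c.val
decreasing_by exact c'.2

variable (O : Finset (Fin t)) (β : Fin t → Γ) (π : Fin t → Fin t → Γ) (κ : Fin t)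

theorem kernelVec_of_le {c : Fin t} (h : c ≤ κ) : kernelVec A O β π κ c = single (β c) 1 := by
  rw [kernelVec, if_pos h]

theorem kernelVec_of_mem {c : Fin t} (h : κ < c) (hc : c ∈ O) : kernelVec A O β π κ c = 0 := by
  rw [kernelVec, if_neg h.not_ge, if_pos hc]

theorem kernelVec_mul {c : Fin t} (h : κ < c) (hc : c ∉ O) :
    kernelVec A O β π κ c * single (π c c) 1 =
      -∑ c' ∈ Finset.univ.filter (· < c), kernelVec A O β π κ c' * single (π c c') 1 := by
  rw [kernelVec, if_neg h.not_ge, if_neg hc, neg_mul, Finset.sum_mul,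
    ← Finset.sum_subtype_eq_sum_filter]
  congr 1
  refine Finset.sum_congr (by ext; simp) fun x _ => ?_
  rw [mul_assoc, single_mul_single, mul_one, sub_add_cancel]

/-- A continued entry is a sum over earlier positions `c'` of terms with valuation at least `β c' +
π c c' - π c c`, and `hπ` says that this exceeds `β c`. -/
theorem addVal_kernelVec (hπ : ∀ c ∉ O, ∀ c' < c, β c + π c c < β c' + π c c') (c : Fin t) :
    (β c : WithTop Γ) ≤ addVal Γ A (kernelVec A O β π κ c) ∧
      (κ < c → (β c : WithTop Γ) < addVal Γ A (kernelVec A O β π κ c)) := by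
  induction c using WellFoundedLT.induction with
  | ind c ih =>
    rcases le_or_gt c κ with h | h
    · rw [kernelVec_of_le O β π κ h, addVal_single_one]
      exact ⟨le_rfl, fun h' => absurd h h'.not_ge⟩
    · suffices hs : (β c : WithTop Γ) < addVal Γ A (kernelVec A O β π κ c) from
        ⟨hs.le, fun _ => hs⟩
      by_cases hc : c ∈ O
      · rw [kernelVec_of_mem O β π κ h hc, AddValuation.map_zero]
        exact WithTop.coe_lt_top _
      · rw [kernelVec, if_neg h.not_ge, if_neg hc, AddValuation.map_neg]
        refine AddValuation.map_lt_sum _ WithTop.coe_ne_top fun c' _ => ?_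
        rw [AddValuation.map_mul, addVal_single_one]
        refine lt_of_lt_of_le ?_ (add_le_add_left (ih c'.1 c'.2).1 _)
        rw [← WithTop.coe_add, WithTop.coe_lt_coe]
        have := hπ c hc c'.1 c'.2
        rw [← add_sub_assoc, lt_sub_iff_add_lt]
        exact this

/-- The vectors attached to complementary sets of positions are orthogonal. -/
theorem sum_kernelVec_mul_kernelVec (β π : Fin t → Fin t → Γ) {κ ζ : Fin t} (hκ : κ ∈ O)
    (hζ : ζ ∉ O) :
    ∑ c, kernelVec A O (β κ) π κ c * kernelVec A Oᶜ (π ζ) β ζ c = 0 := by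
  classical
  -- For `κ < ζ`, one of the two factors vanishes at each position beyond `ζ`, and the entry at `ζ`
  -- was defined to cancel the positions before it. The other case follows by exchanging `O` with
  -- its complement.
  have key : ∀ (O : Finset (Fin t)) (β π : Fin t → Fin t → Γ) (κ ζ : Fin t), κ ∈ O → ζ ∉ O →
      κ < ζ → ∑ c, kernelVec A O (β κ) π κ c * kernelVec A Oᶜ (π ζ) β ζ c = 0 := by
    intro O β π κ ζ hκ hζ hlt
    have hsplit : (Finset.univ : Finset (Fin t)) =
        insert ζ (Finset.univ.filter (· < ζ)) ∪ Finset.univ.filter (ζ < ·) := by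
      ext c
      simp only [Finset.mem_univ, Finset.mem_union, Finset.mem_insert, Finset.mem_filter,
        true_and, true_iff]
      rcases lt_trichotomy c ζ with h | h | h <;> tauto
    rw [hsplit, Finset.sum_union, Finset.sum_insert]
    · have h1 : ∑ c ∈ Finset.univ.filter (ζ < ·),
          kernelVec A O (β κ) π κ c * kernelVec A Oᶜ (π ζ) β ζ c = 0 := by
        refine Finset.sum_eq_zero fun c hc => ?_
        have hc := (Finset.mem_filter.1 hc).2
        by_cases hcO : c ∈ O
        · rw [kernelVec_of_mem O _ _ _ (hlt.trans hc) hcO, zero_mul]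
        · rw [kernelVec_of_mem Oᶜ _ _ _ hc (Finset.mem_compl.2 hcO), mul_zero]
      rw [h1, add_zero, kernelVec_of_le Oᶜ (π ζ) β ζ le_rfl, kernelVec_mul O _ _ _ hlt hζ,
        neg_add_eq_zero]
      refine Finset.sum_congr rfl fun c hc => ?_
      rw [kernelVec_of_le Oᶜ (π ζ) β ζ (Finset.mem_filter.1 hc).2.le]
    · simp
    · rw [Finset.disjoint_left]
      intro c hc hc'
      have hc' := (Finset.mem_filter.1 hc').2
      rcases Finset.mem_insert.1 hc with rfl | hc
      · exact lt_irrefl _ hc'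
      · exact lt_asymm hc' (Finset.mem_filter.1 hc).2
  rcases lt_trichotomy κ ζ with h | h | h
  · exact key O β π κ ζ hκ hζ h
  · exact absurd (h ▸ hκ) hζ
  · have := key Oᶜ π β ζ κ (Finset.mem_compl.2 hζ) (by simpa using hκ) h
    rw [compl_compl] at this
    rw [← this]
    exact Finset.sum_congr rfl fun c _ => mul_comm _ _

variable {m n : ℕ}

/-- One half of the construction of points on the nullcone. -/
theorem addVal_sum_kernelVec {N : ℕ} (x : Fin t → A) (hx : ∀ s : Finset (Fin t), s.Nonempty →
    ∑ κ ∈ s, x κ ≠ 0) (wt : Fin t → Fin N → Γ) (F : Fin t → Fin N → Prop)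
    (col : Fin t → Fin N → Fin t) (hcol : ∀ c i, F c i → col c i ∈ O ∧ c ≤ col c i)
    (α : Fin t → Fin N → Γ) (β π : Fin t → Fin t → Γ)
    (h1 : ∀ κ c i, wt c i ≤ α κ i + β κ c)
    (h3 : ∀ κ c i, F c i ∧ col c i = κ → wt c i = α κ i + β κ c)
    (hπ : ∀ κ, ∀ c ∉ O, ∀ c' < c, β κ c + π c c < β κ c' + π c c') (c : Fin t) (i : Fin N) :
    (wt c i : WithTop Γ) ≤
        addVal Γ A (∑ κ ∈ O, C (x κ) * (single (α κ i) 1 * kernelVec A O (β κ) π κ c)) ∧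
      (F c i → addVal Γ A (∑ κ ∈ O, C (x κ) * (single (α κ i) 1 * kernelVec A O (β κ) π κ c))
        = wt c i) := by
  have := addVal_sum_generic O x (fun s _ hs => hx s hs)
    (fun κ => single (α κ i) 1 * kernelVec A O (β κ) π κ c) (wt c i) (fun κ _ => by
      rcases le_or_gt c κ with h | h
      · left
        refine ⟨α κ i + β κ c, h1 κ c i, ?_⟩
        rw [kernelVec_of_le O _ _ _ h, single_mul_single, mul_one]
      · right
        rw [AddValuation.map_mul, addVal_single_one]
        refine lt_of_le_of_lt (WithTop.coe_le_coe.2 (h1 κ c i)) ?_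
        rw [WithTop.coe_add]
        exact WithTop.add_lt_add_left WithTop.coe_ne_top
          ((addVal_kernelVec O (β κ) π κ (hπ κ) c).2 h))
  refine ⟨this.1, fun hF => this.2 ⟨col c i, (hcol c i hF).1, ?_⟩⟩
  rw [kernelVec_of_le O _ _ _ (hcol c i hF).2, single_mul_single, mul_one, h3 _ c i ⟨hF, rfl⟩]

/-- Points of the nullcone with prescribed valuations on a set of cells without long chains. -/
theorem exists_nullcone_point (x : Fin t → A) (hx : ∀ s : Finset (Fin t), s.Nonempty →
    ∑ κ ∈ s, x κ ≠ 0) (hm : 0 < m) (hn : 0 < n) (wY : Fin t → Fin m → Γ) (wZ : Fin t → Fin n → Γ)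
    (hY : ∀ c c' i i', c < c' → i < i' → wY c i + wY c' i' < wY c i' + wY c' i)
    (hZ : ∀ c c' i i', c < c' → i < i' → wZ c i + wZ c' i' < wZ c i' + wZ c' i)
    (hYZ : ∀ c c' i j, c < c' → wY c' i + wZ c' j < wY c i + wZ c j)
    (FY : Fin t → Fin m → Prop) (FZ : Fin t → Fin n → Prop)
    (hF : ∀ k ≤ t, maxChainLength FY k + maxChainLength FZ k ≤ t - k) :
    ∃ (Y : Matrix (Fin m) (Fin t) (HahnSeries Γ A)) (Z : Matrix (Fin t) (Fin n) (HahnSeries Γ A)),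
      Y * Z = 0 ∧
      (∀ i c, (wY c i : WithTop Γ) ≤ addVal Γ A (Y i c) ∧
        (FY c i → addVal Γ A (Y i c) = wY c i)) ∧
      ∀ c j, (wZ c j : WithTop Γ) ≤ addVal Γ A (Z c j) ∧
        (FZ c j → addVal Γ A (Z c j) = wZ c j) := by
  classical
  -- `D` has exactly as many large elements as `FZ` requires; by `hF` its complement then has enough
  -- for `FY`.
  obtain ⟨D, hD⟩ := exists_countGE_eq_maxChainLength FZ
  obtain ⟨colY, hcolY, hantiY⟩ := exists_chain_colouring FY Dᶜ (by
    intro k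
    rcases le_or_gt k t with hk | hk
    · have h1 := countGE_add_compl D hk
      have h2 := hF k hk
      have h3 := hD k
      omega
    · have := maxChainLength_le (F := FY) (k := k)
      omega)
  obtain ⟨colZ, hcolZ, hantiZ⟩ := exists_chain_colouring FZ D fun k => (hD k).ge
  have hpY := fun κ => exists_potentials wY hm hY (fun c i => FY c i ∧ colY c i = κ)
    fun c c' i i' hc hi h h' => hantiY c i c' i' h.1 h'.1 hc hi (h.2.trans h'.2.symm)
  have hpZ := fun κ => exists_potentials wZ hn hZ (fun c i => FZ c i ∧ colZ c i = κ)
    fun c c' i i' hc hi h h' => hantiZ c i c' i' h.1 h'.1 hc hi (h.2.trans h'.2.symm)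
  choose α β hαβ1 hαβ2 hαβ3 using hpY
  choose ω π hωπ1 hωπ2 hωπ3 using hpZ
  -- Choose `i` and `j` where the potentials are tight at `c` and compare with `c'` through `hYZ`.
  have hdrop : ∀ κ ζ c c', c' < c → β κ c + π ζ c < β κ c' + π ζ c' := by
    intro κ ζ c c' hc
    obtain ⟨i, hi⟩ := hαβ2 κ c
    obtain ⟨j, hj⟩ := hωπ2 ζ c
    have h1 := hαβ1 κ c' i
    have h2 := hωπ1 ζ c' j
    have h3 := hYZ c' c i j hc
    rw [hi, hj] at h3
    have h4 := h3.trans_le (add_le_add h1 h2)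
    have h5 : α κ i + ω ζ j + (β κ c + π ζ c) < α κ i + ω ζ j + (β κ c' + π ζ c') := by
      convert h4 using 1 <;> abel
    exact lt_of_add_lt_add_left h5
  -- Both matrices are generic sums of rank-one matrices indexed by the colours. The vectors indexed
  -- by `Dᶜ` are orthogonal to those indexed by `D`, so the product is zero.
  refine ⟨Matrix.of fun i c => ∑ κ ∈ Dᶜ,
      C (x κ) * (single (α κ i) 1 * kernelVec A Dᶜ (β κ) π κ c),
    Matrix.of fun c j => ∑ ζ ∈ D, C (x ζ) * (single (ω ζ j) 1 * kernelVec A D (π ζ) β ζ c),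
    ?_, ?_, ?_⟩
  · ext1 i j
    rw [Matrix.mul_apply, Matrix.zero_apply]
    simp only [Matrix.of_apply, Finset.sum_mul, Finset.mul_sum]
    rw [Finset.sum_comm]
    refine Finset.sum_eq_zero fun ζ hζ => ?_
    rw [Finset.sum_comm]
    refine Finset.sum_eq_zero fun κ hκ => ?_
    have horth := sum_kernelVec_mul_kernelVec (A := A) Dᶜ β π hκ (by simpa using hζ)
    rw [compl_compl] at horth
    have : ∀ c, C (x κ) * (single (α κ i) 1 * kernelVec A Dᶜ (β κ) π κ c) *
        (C (x ζ) * (single (ω ζ j) 1 * kernelVec A D (π ζ) β ζ c)) =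
        C (x κ) * single (α κ i) 1 * (C (x ζ) * single (ω ζ j) 1) *
          (kernelVec A Dᶜ (β κ) π κ c * kernelVec A D (π ζ) β ζ c) := fun c => by ring
    simp only [this]
    rw [← Finset.mul_sum, horth, mul_zero]
  · intro i c
    exact addVal_sum_kernelVec Dᶜ x hx wY FY colY hcolY α β π hαβ1 hαβ3
      (fun κ c _ c' hc => hdrop κ c c c' hc) c i
  · intro c j
    exact addVal_sum_kernelVec D x hx wZ FZ colZ hcolZ ω π β hωπ1 hωπ3
      (fun ζ c _ c' hc => by rw [add_comm, add_comm (π ζ c')]; exact hdrop c ζ c c' hc) c j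

/-- Matrices of small rank with prescribed valuations on a set of cells without long chains. -/
theorem exists_rank_le_point {r : ℕ} (x : Fin r → A) (hx : ∀ s : Finset (Fin r), s.Nonempty →
    ∑ κ ∈ s, x κ ≠ 0) (hm : 0 < m) (wY : Fin t → Fin m → Γ)
    (hY : ∀ c c' i i', c < c' → i < i' → wY c i + wY c' i' < wY c i' + wY c' i)
    (FY : Fin t → Fin m → Prop) (hF : maxChainLength FY 0 ≤ r) :
    ∃ (U : Matrix (Fin m) (Fin r) (HahnSeries Γ A)) (V : Matrix (Fin r) (Fin t) (HahnSeries Γ A)),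
      ∀ i c, (wY c i : WithTop Γ) ≤ addVal Γ A ((U * V) i c) ∧
        (FY c i → addVal Γ A ((U * V) i c) = wY c i) := by
  classical
  obtain ⟨h, h1, h2⟩ := exists_chain_rank FY
  have hr : ∀ c i, FY c i → h c i < r := fun c i hc => by
    refine (h1 c i hc).trans_le (le_trans ?_ hF)
    obtain ⟨c', i', hc', hi', hF', -⟩ := hasChain_maxChainLength (F := FY) (k := c)
    exact HasChain.le_maxChainLength ⟨c', i', hc', hi', hF', fun _ => Nat.zero_le _⟩
  -- Cells of equal rank form an antichain, so one rank-one matrix for each of the `r` possible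
  -- ranks suffices.
  have hp := fun κ : Fin r => exists_potentials wY hm hY (fun c i => FY c i ∧ h c i = κ)
    fun c c' i i' hc hi hh hh' => by
      have := h2 c i c' i' hh'.1 hc hi
      omega
  choose α β hαβ1 hαβ2 hαβ3 using hp
  refine ⟨Matrix.of fun i κ => C (x κ) * single (α κ i) 1,
    Matrix.of fun κ c => single (β κ c) 1, fun i c => ?_⟩
  have := addVal_sum_generic Finset.univ x (fun s _ hs => hx s hs)
    (fun κ => single (α κ i + β κ c) 1) (wY c i)
    (fun κ _ => Or.inl ⟨α κ i + β κ c, hαβ1 κ c i, rfl⟩)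
  have hmul : ((Matrix.of fun i κ => C (x κ) * single (α κ i) 1 :
        Matrix (Fin m) (Fin r) (HahnSeries Γ A)) *
      (Matrix.of fun κ c => single (β κ c) 1 : Matrix (Fin r) (Fin t) (HahnSeries Γ A))) i c =
      ∑ κ, C (x κ) * single (α κ i + β κ c) 1 := by
    rw [Matrix.mul_apply]
    refine Finset.sum_congr rfl fun κ _ => ?_
    rw [Matrix.of_apply, Matrix.of_apply, mul_assoc, single_mul_single, mul_one]
  rw [hmul]
  refine ⟨this.1, fun hc => this.2 ⟨⟨h c i, hr c i hc⟩, Finset.mem_univ _, ?_⟩⟩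
  rw [hαβ3 ⟨h c i, hr c i hc⟩ c i ⟨hc, rfl⟩]

end ValuedPoints

/-! ### Polynomials that do not vanish at valued points. -/

section Nonvanishing

open HahnSeries

variable {Γ : Type w} [AddCommGroup Γ] [LinearOrder Γ] [IsOrderedAddMonoid Γ] {A : Type u} [Field A]

theorem AddValuation.map_prod_pow {R Γ₀ ι : Type*} [CommRing R]
    [LinearOrderedAddCommMonoidWithTop Γ₀] (v : AddValuation R Γ₀)
    (s : Finset ι) (x : ι → R) (d : ι → ℕ) :
    v (∏ i ∈ s, x i ^ d i) = ∑ i ∈ s, d i • v (x i) := by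
  classical
  induction s using Finset.induction_on with
  | empty => simp
  | insert a s ha ih => rw [Finset.prod_insert ha, Finset.sum_insert ha, v.map_mul, v.map_pow, ih]

/-- A nonzero polynomial does not vanish at points with suitable valuations. -/
theorem MvPolynomial.exists_forall_aeval_ne_zero {K : Type v} [Field K] [Algebra K A]
    {σ : Type*} (w : σ → Γ) (hw : LinearIndependent ℕ w) {g : MvPolynomial σ K} (hg : g ≠ 0) :
    ∃ e ∈ g.support, ∀ x : σ → HahnSeries Γ A,
      (∀ v, (w v : WithTop Γ) ≤ addVal Γ A (x v) ∧ (e v ≠ 0 → addVal Γ A (x v) = w v)) →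
      MvPolynomial.aeval x g ≠ 0 := by
  classical
  -- By independence of the weights the exponent of least value is unique, so its term cannot be
  -- cancelled.
  obtain ⟨e, he, hmin⟩ := g.support.exists_min_image (Finsupp.linearCombination ℕ w)
    (MvPolynomial.support_nonempty.2 hg)
  refine ⟨e, he, fun x hx h0 => ?_⟩
  have hcoe : ∀ d : σ →₀ ℕ, ((Finsupp.linearCombination ℕ w d : Γ) : WithTop Γ) =
      ∑ i ∈ d.support, d i • (w i : WithTop Γ) := by
    intro d
    rw [Finsupp.linearCombination_apply, Finsupp.sum, WithTop.coe_sum]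
    rfl
  have hC : ∀ d ∈ g.support, addVal Γ A (algebraMap K (HahnSeries Γ A) (g.coeff d)) = 0 := by
    intro d hd
    rw [HahnSeries.algebraMap_apply, HahnSeries.C_apply, addVal_apply, orderTop_single, WithTop.coe_zero]
    simpa using hd
  have hle : ∀ d ∈ g.support, ((Finsupp.linearCombination ℕ w d : Γ) : WithTop Γ) ≤
      addVal Γ A (algebraMap K (HahnSeries Γ A) (g.coeff d) * ∏ i ∈ d.support, x i ^ d i) := by
    intro d hd
    rw [AddValuation.map_mul, hC d hd, zero_add, AddValuation.map_prod_pow, hcoe]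
    exact Finset.sum_le_sum fun i _ => nsmul_le_nsmul_right (hx i).1 _
  have heq : addVal Γ A (algebraMap K (HahnSeries Γ A) (g.coeff e) *
      ∏ i ∈ e.support, x i ^ e i) = (Finsupp.linearCombination ℕ w e : Γ) := by
    rw [AddValuation.map_mul, hC e he, zero_add, AddValuation.map_prod_pow, hcoe]
    exact Finset.sum_congr rfl fun i hi => by rw [(hx i).2 (Finsupp.mem_support_iff.1 hi)]
  rw [MvPolynomial.aeval_def, MvPolynomial.eval₂_eq, ← Finset.add_sum_erase _ _ he] at h0
  have hlt : ((Finsupp.linearCombination ℕ w e : Γ) : WithTop Γ) <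
      addVal Γ A (∑ d ∈ g.support.erase e,
        algebraMap K (HahnSeries Γ A) (g.coeff d) * ∏ i ∈ d.support, x i ^ d i) := by
    refine AddValuation.map_lt_sum _ WithTop.coe_ne_top fun d hd => ?_
    have hd' := Finset.mem_of_mem_erase hd
    refine lt_of_lt_of_le (WithTop.coe_lt_coe.2 (lt_of_le_of_ne (hmin d hd') fun h => ?_))
      (hle d hd')
    exact Finset.ne_of_mem_erase hd (hw h).symm
  rw [eq_neg_of_add_eq_zero_left h0, AddValuation.map_neg] at heq
  exact hlt.ne' heq

end Nonvanishing

/-! ### Generic coefficients and generic weights. -/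

section GenericWeights

variable (K : Type u) [Field K]

/-- The field of coefficients of the valued points. -/
abbrev CoeffField : Type u := FractionRing (Polynomial K)

/-- `K` may be finite, so the coefficients are taken in `K(X)`, where sums of distinct powers of `X`
do not vanish. -/
theorem sum_X_pow_ne_zero {r : ℕ} (s : Finset (Fin r)) (hs : s.Nonempty) :
    ∑ κ ∈ s, algebraMap (Polynomial K) (CoeffField K) (Polynomial.X ^ (κ : ℕ)) ≠ 0 := by
  obtain ⟨κ, hκ⟩ := hs
  rw [← map_sum, Ne, FaithfulSMul.algebraMap_eq_zero_iff]
  intro h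
  have := congrArg (Polynomial.coeff · (κ : ℕ)) h
  simp [Polynomial.finsetSum_coeff, Polynomial.coeff_X_pow, ← Fin.ext_iff, hκ] at this

variable (m t n : ℕ)

/-- The value group of the valued points. -/
abbrev ValueGroup : Type :=
  ℤ ×ₗ Lex (Fin (Fintype.card ((Fin m × Fin t) ⊕ (Fin t × Fin n))) → ℤ)

/-- The prescribed valuation of a variable, refining `-diagWeight`. -/
noncomputable def genericWeight (v : (Fin m × Fin t) ⊕ (Fin t × Fin n)) : ValueGroup m t n :=
  toLex (-(diagWeight m t n v : ℤ), toLex (Pi.single (Fintype.equivFin _ v) 1))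

/-- The second component of the value group records the exponent itself. -/
theorem linearIndependent_genericWeight : LinearIndependent ℕ (genericWeight m t n) := by
  classical
  have key : ∀ (e : (Fin m × Fin t) ⊕ (Fin t × Fin n) →₀ ℕ) v,
      ofLex (ofLex (Finsupp.linearCombination ℕ (genericWeight m t n) e)).2
        (Fintype.equivFin _ v) = e v := by
    intro e v
    let f : ValueGroup m t n →+ ℤ :=
      { toFun := fun γ => ofLex (ofLex γ).2 (Fintype.equivFin _ v)
        map_zero' := rfl
        map_add' := fun _ _ => rfl }
    change f _ = _
    have hf : ∀ u, f (genericWeight m t n u) = if u = v then 1 else 0 := by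
      intro u
      change (Pi.single (Fintype.equivFin _ u) 1 : _ → ℤ) (Fintype.equivFin _ v) = _
      rw [Pi.single_apply]
      simp [eq_comm]
    rw [Finsupp.linearCombination_apply, Finsupp.sum, map_sum]
    simp only [map_nsmul, hf]
    simp +contextual
  intro e e' h
  ext v
  have h1 := key e v
  have h2 := key e' v
  rw [h] at h1
  exact_mod_cast h1.symm.trans h2

variable {m t n}

theorem toLex_lt_of_fst {α β : Type*} [LT α] [LT β] {x y : α ×ₗ β}
    (h : (ofLex x).1 < (ofLex y).1) : x < y :=
  Prod.Lex.lt_iff.2 (Or.inl h)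

/-- The first components differ by `(c' - c) * (i' - i) > 0`. -/
theorem genericWeight_monge_left {c c' : Fin t} {i i' : Fin m} (hc : c < c') (hi : i < i') :
    genericWeight m t n (Sum.inl (i, c)) + genericWeight m t n (Sum.inl (i', c')) <
      genericWeight m t n (Sum.inl (i', c)) + genericWeight m t n (Sum.inl (i, c')) := by
  refine toLex_lt_of_fst ?_
  change -(_ : ℤ) + -(_ : ℤ) < -(_ : ℤ) + -(_ : ℤ)
  simp only [diagWeight, Sum.elim_inl]
  push_cast
  have h1 : (c : ℤ) < c' := by exact_mod_cast hc
  have h2 : (i : ℤ) < i' := by exact_mod_cast hi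
  nlinarith

theorem genericWeight_monge_right {c c' : Fin t} {j j' : Fin n} (hc : c < c') (hj : j < j') :
    genericWeight m t n (Sum.inr (c, j)) + genericWeight m t n (Sum.inr (c', j')) <
      genericWeight m t n (Sum.inr (c, j')) + genericWeight m t n (Sum.inr (c', j)) := by
  refine toLex_lt_of_fst ?_
  change -(_ : ℤ) + -(_ : ℤ) < -(_ : ℤ) + -(_ : ℤ)
  simp only [diagWeight, Sum.elim_inr]
  push_cast
  have h1 : (c : ℤ) < c' := by exact_mod_cast hc
  have h2 : (j : ℤ) < j' := by exact_mod_cast hj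
  nlinarith

/-- `diagWeight` grows with the index shared by the two matrices. This makes the continued entries
of `kernelVec` negligible. -/
theorem genericWeight_add_lt {c c' : Fin t} (i : Fin m) (j : Fin n) (hc : c < c') :
    genericWeight m t n (Sum.inl (i, c')) + genericWeight m t n (Sum.inr (c', j)) <
      genericWeight m t n (Sum.inl (i, c)) + genericWeight m t n (Sum.inr (c, j)) := by
  refine toLex_lt_of_fst ?_
  change -(_ : ℤ) + -(_ : ℤ) < -(_ : ℤ) + -(_ : ℤ)
  rw [← neg_add, ← neg_add, neg_lt_neg_iff]
  have hc' : (c : ℕ) < c' := hc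
  have h1 : (i : ℕ) * c ≤ i * c' := Nat.mul_le_mul_left _ hc'.le
  have h2 : (c : ℕ) * j ≤ c' * j := Nat.mul_le_mul_right _ hc'.le
  have h3 : weightFactor m t n * (2 * c) < weightFactor m t n * (2 * c') :=
    Nat.mul_lt_mul_of_pos_left (by omega) (Nat.succ_pos _)
  simp only [diagWeight, Sum.elim_inl, Sum.elim_inr]
  exact_mod_cast (by omega : weightFactor m t n * (2 * c) + i * c +
    (weightFactor m t n * (2 * c) + c * j) < weightFactor m t n * (2 * c') + i * c' +
    (weightFactor m t n * (2 * c') + c' * j))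

end GenericWeights

/-! ### Strata given by maximal nonzero minors. -/

section MaximalMinors

variable {m t n : ℕ}

/-- Take a nonzero minor of maximal size, possibly the empty one; all minors bordering it vanish. -/
theorem exists_minor_ne_zero {L : Type u} [Field L] (Y : Matrix (Fin m) (Fin t) L) :
    ∃ (r : ℕ) (R : Fin r ↪ Fin m) (C : Fin r ↪ Fin t), (Y.submatrix R C).det ≠ 0 ∧
      schurDefect Y R C = 0 := by
  classical
  set P : ℕ → Prop := fun r =>
    ∃ (R : Fin r → Fin m) (C : Fin r → Fin t), (Y.submatrix R C).det ≠ 0 with hP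
  have hinj : ∀ {r} {R : Fin r → Fin m} {C : Fin r → Fin t}, (Y.submatrix R C).det ≠ 0 →
      Function.Injective R ∧ Function.Injective C := by
    intro r R C h
    refine ⟨fun a b hab => ?_, fun a b hab => ?_⟩
    · by_contra hne
      exact h (Matrix.det_zero_of_row_eq hne (by ext x; simp [hab]))
    · by_contra hne
      exact h (Matrix.det_zero_of_column_eq hne fun x => by simp [hab])
  have h0 : P 0 := ⟨Fin.elim0, Fin.elim0, by simp⟩
  have hle : ∀ r, P r → r ≤ m := by
    rintro r ⟨R, C, h⟩
    simpa using Fintype.card_le_of_injective R (hinj h).1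
  obtain ⟨R, C, h⟩ := Nat.findGreatest_spec (P := P) (Nat.zero_le m) h0
  refine ⟨_, ⟨R, (hinj h).1⟩, ⟨C, (hinj h).2⟩, h, schurDefect_eq_zero Y R C h ?_⟩
  intro R' C'
  by_contra hne
  let E : Fin (Nat.findGreatest P m + 1) ≃ Fin (Nat.findGreatest P m) ⊕ Unit :=
    Fintype.equivOfCardEq (by simp)
  have hs : P (Nat.findGreatest P m + 1) := by
    refine ⟨R' ∘ E, C' ∘ E, ?_⟩
    rw [← Matrix.det_submatrix_equiv_self E] at hne
    exact hne
  have := Nat.le_findGreatest (hle _ hs) hs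
  omega

theorem le_of_minor_mul_ne_zero {L : Type u} [Field L] {r r₀ : ℕ} (U : Matrix (Fin m) (Fin r₀) L)
    (V : Matrix (Fin r₀) (Fin t) L) (R : Fin r → Fin m) (C : Fin r → Fin t)
    (h : ((U * V).submatrix R C).det ≠ 0) : r ≤ r₀ := by
  by_contra hr
  -- If `r₀ < r`, the minor lies in a positive power of the zero ideal.
  have := det_mul_add_mem_pow (⊥ : Ideal L) (U.submatrix R id) (V.submatrix id C) 0 (by simp)
  rw [add_zero, Fintype.card_fin, Fintype.card_fin] at this
  have h2 := Ideal.pow_le_self (by omega) this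
  exact h (Ideal.mem_bot.1 h2)

theorem map_eq_zero_of_mem_saturationBy {S : Type u} {L : Type v} [CommRing S] [Field L]
    (ψ : S →+* L) {ι : Type*} {gens : ι → S} {δ g : S} (hgens : ∀ x, ψ (gens x) = 0)
    (hδ : ψ δ ≠ 0) (hg : g ∈ (Ideal.span (Set.range gens)).saturationBy δ) : ψ g = 0 := by
  obtain ⟨N, hN⟩ := Ideal.mem_saturationBy.1 hg
  have hle : Ideal.span (Set.range gens) ≤ RingHom.ker ψ := by
    rw [Ideal.span_le]
    rintro _ ⟨x, rfl⟩
    exact hgens x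
  have := hle hN
  rw [RingHom.mem_ker, map_mul, map_pow] at this
  exact (mul_eq_zero.1 this).resolve_left (pow_ne_zero _ hδ)

end MaximalMinors

/-! ### Ideals as intersections of the ideals of strata. -/

section Decompositions

variable {m t n : ℕ}

theorem sum_single_one_le {ι σ : Type*} [Fintype ι] (v : ι → σ) (hv : Function.Injective v)
    (e : σ →₀ ℕ) (h : ∀ l, e (v l) ≠ 0) : ∑ l, Finsupp.single (v l) 1 ≤ e := by
  classical
  intro u
  rw [Finsupp.finsetSum_apply]
  by_cases hu : ∃ l, v l = u
  · obtain ⟨l, rfl⟩ := hu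
    rw [Fintype.sum_eq_single l fun l' hl' => Finsupp.single_eq_of_ne' fun h' => hl' (hv h'),
      Finsupp.single_eq_same]
    exact Nat.one_le_iff_ne_zero.2 (h l)
  · push Not at hu
    rw [Finset.sum_eq_zero fun l _ => Finsupp.single_eq_of_ne' (hu l)]
    exact Nat.zero_le _

/-- The cells of the first matrix that occur in an exponent, indexed by column and row. -/
def cellsY (e : (Fin m × Fin t) ⊕ (Fin t × Fin n) →₀ ℕ) (c : Fin t) (i : Fin m) : Prop :=
  e (Sum.inl (i, c)) ≠ 0

/-- The cells of the second matrix that occur in an exponent. -/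
def cellsZ (e : (Fin m × Fin t) ⊕ (Fin t × Fin n) →₀ ℕ) (c : Fin t) (j : Fin n) : Prop :=
  e (Sum.inr (c, j)) ≠ 0

variable (K : Type u) [Field K]

theorem exists_hasLead_mem_minorsIdeal {r : ℕ} (e : (Fin m × Fin t) ⊕ (Fin t × Fin n) →₀ ℕ)
    (he : r < maxChainLength (cellsY e) 0) :
    ∃ q ∈ minorsIdeal (r + 1) (matY K m t n), ∃ e₀ ≤ e, HasLead (diagWeight m t n) q e₀ := by
  obtain ⟨c, i, hc, hi, hF, -⟩ := (hasChain_maxChainLength (F := cellsY e) (k := 0)).mono he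
  refine ⟨((matY K m t n).submatrix i c).det, Ideal.subset_span
    ⟨OrderEmbedding.ofStrictMono i hi, OrderEmbedding.ofStrictMono c hc, rfl⟩, _, ?_,
    hasLead_minorY K i c hi hc⟩
  refine sum_single_one_le (fun l => Sum.inl (i l, c l)) (fun l l' h => ?_) e hF
  exact hi.injective (congrArg Prod.fst (Sum.inl_injective h))

/-- The two chains are the diagonals of a mixed minor with an identity block of size `k`, whose
leading monomial is squarefree and divides `e`. -/
theorem exists_hasLead_mem_nullconeIdeal (e : (Fin m × Fin t) ⊕ (Fin t × Fin n) →₀ ℕ)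
    (he : ∃ k ≤ t, t - k < maxChainLength (cellsY e) k + maxChainLength (cellsZ e) k) :
    ∃ q ∈ nullconeIdeal K m t n, ∃ e₀ ≤ e, HasLead (diagWeight m t n) q e₀ := by
  obtain ⟨k, hk, hlt⟩ := he
  have hleY := maxChainLength_le (F := cellsY e) (k := k)
  obtain ⟨c, i, hc, hi, hFY, hkc⟩ := hasChain_maxChainLength (F := cellsY e) (k := k)
  -- The second chain is shortened so that the lengths add up to `t - k + 1`. The mixed matrix then
  -- has size `t + 1`, and its determinant lies in the first power of the ideal.
  obtain ⟨d, j, hd, hj, hFZ, hkd⟩ := (hasChain_maxChainLength (F := cellsZ e) (k := k)).mono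
    (show t - k + 1 - maxChainLength (cellsY e) k ≤ _ by omega)
  refine ⟨(mixedMatrix (matY K m t n) (matZ K m t n) i c d j (Fin.castLE hk)).det, ?_, _, ?_,
    hasLead_det_mixedMatrix i c d j hk K hi hc hd hj hkc hkd⟩
  · refine Ideal.pow_le_self ?_ (det_mixedMatrix_mem_pow (nullconeIdeal K m t n) _ _ i c d j
      (Fin.castLE hk) fun i j => Ideal.subset_span ⟨i, j, rfl⟩)
    omega
  · have := sum_single_one_le (Sum.elim (fun l => Sum.inl (i l, c l)) fun l => Sum.inr (d l, j l))
      (by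
        rintro (l | l) (l' | l') h
        · exact congrArg _ (hi.injective (congrArg Prod.fst (Sum.inl_injective h)))
        · exact absurd h Sum.inl_ne_inr
        · exact absurd h Sum.inr_ne_inl
        · exact congrArg _ (hj.injective (congrArg Prod.snd (Sum.inr_injective h)))) e
      (by rintro (l | l); exacts [hFY l, hFZ l])
    rwa [Fintype.sum_sum_type] at this

/-- The ideal of the closure of the locus `Y * Z = 0`, `rank Y ≤ r` where the minor of `Y` with
rows `R` and columns `C` does not vanish. -/
noncomputable def nullconeStratum (n : ℕ) {r : ℕ} (R : Fin r ↪ Fin m) (C : Fin r ↪ Fin t) :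
    Ideal (PolyYZ K m t n) :=
  (Ideal.span (Set.range (nullconeGens (matY K m t n) (matZ K m t n) R C))).saturationBy
    ((matY K m t n).submatrix R C).det

/-- The ideal of the closure of the locus `rank Y ≤ r` where the minor of `Y` with rows `R` and
columns `C` does not vanish. -/
noncomputable def rankStratum (n : ℕ) {r : ℕ} (R : Fin r ↪ Fin m) (C : Fin r ↪ Fin t) :
    Ideal (PolyYZ K m t n) :=
  (Ideal.span (Set.range (rankGens (matY K m t n) R C))).saturationBy
    ((matY K m t n).submatrix R C).det

variable {K}

theorem map_schurDefect_apply {L : Type v} [Field L] (ψ : PolyYZ K m t n →+* L) {r : ℕ}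
    {R : Fin r → Fin m} {C : Fin r → Fin t}
    (h : schurDefect ((matY K m t n).map ψ) R C = 0) (i : Fin m) (c : Fin t) :
    ψ (schurDefect (matY K m t n) R C i c) = 0 := by
  rw [← schurDefect_map] at h
  exact congrFun (congrFun h i) c

theorem map_minor {L : Type v} [Field L] (ψ : PolyYZ K m t n →+* L) {r : ℕ}
    (R : Fin r → Fin m) (C : Fin r → Fin t) :
    ψ ((matY K m t n).submatrix R C).det = (((matY K m t n).map ψ).submatrix R C).det := by
  rw [RingHom.map_det]; rfl

/-- Elements of all strata vanish at every point of the nullcone. -/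
theorem map_eq_zero_of_mem_nullconeStratum {L : Type v} [Field L] (ψ : PolyYZ K m t n →+* L)
    (hψ : (matY K m t n).map ψ * (matZ K m t n).map ψ = 0) {g : PolyYZ K m t n}
    (hg : ∀ (r : ℕ) (R : Fin r ↪ Fin m) (C : Fin r ↪ Fin t), g ∈ nullconeStratum K n R C) :
    ψ g = 0 := by
  -- The point lies on the stratum of a maximal nonzero minor of the image of `Y`.
  obtain ⟨r, R, C, hδ, hdef⟩ := exists_minor_ne_zero ((matY K m t n).map ψ)
  refine map_eq_zero_of_mem_saturationBy ψ ?_ (by rwa [map_minor]) (hg r R C)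
  rintro (x | x)
  · exact map_schurDefect_apply ψ hdef _ _
  · rw [← Matrix.map_mul] at hψ
    exact congrFun (congrFun hψ (R x.1)) x.2

theorem map_eq_zero_of_mem_rankStratum {L : Type v} [Field L] (ψ : PolyYZ K m t n →+* L) {r₀ : ℕ}
    (U : Matrix (Fin m) (Fin r₀) L) (V : Matrix (Fin r₀) (Fin t) L)
    (hψ : (matY K m t n).map ψ = U * V) {g : PolyYZ K m t n}
    (hg : ∀ r ≤ r₀, ∀ (R : Fin r ↪ Fin m) (C : Fin r ↪ Fin t), g ∈ rankStratum K n R C) :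
    ψ g = 0 := by
  obtain ⟨r, R, C, hδ, hdef⟩ := exists_minor_ne_zero ((matY K m t n).map ψ)
  have hr : r ≤ r₀ := le_of_minor_mul_ne_zero U V R C (hψ ▸ hδ)
  refine map_eq_zero_of_mem_saturationBy ψ (fun x => ?_) (by rwa [map_minor]) (hg r hr R C)
  exact map_schurDefect_apply ψ hdef _ _

theorem nullconeIdeal_le_nullconeStratum {r : ℕ} (R : Fin r ↪ Fin m) (C : Fin r ↪ Fin t) :
    nullconeIdeal K m t n ≤ nullconeStratum K n R C := by
  rw [nullconeIdeal, entriesIdeal, Ideal.span_le]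
  rintro _ ⟨i, j, rfl⟩
  refine Ideal.mem_saturationBy.2 ⟨1, ?_⟩
  rw [pow_one]
  exact productIdeal_smul_mem _ _ R C _ (fun x => Ideal.subset_span (Set.mem_range_self x)) i j

theorem minorsIdeal_le_rankStratum {r₀ r : ℕ} (hr : r ≤ r₀) (R : Fin r ↪ Fin m)
    (C : Fin r ↪ Fin t) : minorsIdeal (r₀ + 1) (matY K m t n) ≤ rankStratum K n R C := by
  rw [minorsIdeal, Ideal.span_le]
  rintro _ ⟨f, g, rfl⟩
  obtain ⟨M, hM⟩ := vanishesToOrder_det_submatrix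
    (Ideal.span (Set.range (rankGens (matY K m t n) R C))) _ (matY K m t n) f g _ _ _
    (smul_eq_add_schurDefect (matY K m t n) R C)
    (schurDefect_mem_of_rankGens _ R C _ fun x => Ideal.subset_span (Set.mem_range_self x))
  refine Ideal.mem_saturationBy.2 ⟨M, Ideal.pow_le_self ?_ hM⟩
  rw [Fintype.card_fin]
  omega

theorem aeval_map_matY {L : Type*} [CommRing L] [Algebra K L]
    (x : (Fin m × Fin t) ⊕ (Fin t × Fin n) → L) :
    (matY K m t n).map (MvPolynomial.aeval x : PolyYZ K m t n →ₐ[K] L) =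
      Matrix.of fun i c => x (Sum.inl (i, c)) := by
  ext i c
  simp [matY]

theorem aeval_map_matZ {L : Type*} [CommRing L] [Algebra K L]
    (x : (Fin m × Fin t) ⊕ (Fin t × Fin n) → L) :
    (matZ K m t n).map (MvPolynomial.aeval x : PolyYZ K m t n →ₐ[K] L) =
      Matrix.of fun c j => x (Sum.inr (c, j)) := by
  ext i c
  simp [matZ]

/-- The nullcone is the union of its strata, scheme-theoretically. -/
theorem mem_nullconeIdeal_iff (hm : 0 < m) (hn : 0 < n) (g : PolyYZ K m t n) :
    g ∈ nullconeIdeal K m t n ↔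
      ∀ (r : ℕ) (R : Fin r ↪ Fin m) (C : Fin r ↪ Fin t), g ∈ nullconeStratum K n R C := by
  refine ⟨fun hg r R C => nullconeIdeal_le_nullconeStratum R C hg, fun hg => ?_⟩
  obtain ⟨g', hgg', hred⟩ := exists_reduced_representative (diagWeight m t n)
    (nullconeIdeal K m t n) _ (exists_hasLead_mem_nullconeIdeal K) g
  have hg' : ∀ (r : ℕ) (R : Fin r ↪ Fin m) (C : Fin r ↪ Fin t), g' ∈ nullconeStratum K n R C := by
    intro r R C
    have := sub_mem (hg r R C) (nullconeIdeal_le_nullconeStratum R C hgg')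
    rwa [sub_sub_cancel] at this
  by_cases h0 : g' = 0
  · rwa [h0, sub_zero] at hgg'
  exfalso
  -- The exponent `e` contains no forbidden leading monomial, so its chains are short enough for a
  -- point of the nullcone with the prescribed valuations to exist. There `g'` is nonzero, although
  -- it lies in all strata.
  obtain ⟨e, he, hne⟩ := MvPolynomial.exists_forall_aeval_ne_zero (A := CoeffField K)
    (genericWeight m t n) (linearIndependent_genericWeight m t n) h0
  have hgood := hred e he
  push Not at hgood
  obtain ⟨Y, Z, hYZ, hY, hZ⟩ := exists_nullcone_point _ (sum_X_pow_ne_zero K (r := t)) hm hn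
    (fun c i => genericWeight m t n (Sum.inl (i, c))) (fun c j => genericWeight m t n (Sum.inr (c, j)))
    (fun _ _ _ _ => genericWeight_monge_left) (fun _ _ _ _ => genericWeight_monge_right)
    (fun _ _ i j => genericWeight_add_lt i j) (cellsY e) (cellsZ e) hgood
  set x : (Fin m × Fin t) ⊕ (Fin t × Fin n) → HahnSeries (ValueGroup m t n) (CoeffField K) :=
    Sum.elim (fun v => Y v.1 v.2) fun v => Z v.1 v.2
  refine hne x ?_ (map_eq_zero_of_mem_nullconeStratum
    (MvPolynomial.aeval x : PolyYZ K m t n →ₐ[K] _).toRingHom ?_ hg')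
  · rintro (v | v)
    · exact hY v.1 v.2
    · exact hZ v.1 v.2
  · exact (congrArg₂ (· * ·) (aeval_map_matY x) (aeval_map_matZ x)).trans hYZ

/-- A determinantal locus is the union of its strata, scheme-theoretically. -/
theorem mem_minorsIdeal_iff (hm : 0 < m) (r₀ : ℕ) (g : PolyYZ K m t n) :
    g ∈ minorsIdeal (r₀ + 1) (matY K m t n) ↔
      ∀ r ≤ r₀, ∀ (R : Fin r ↪ Fin m) (C : Fin r ↪ Fin t), g ∈ rankStratum K n R C := by
  refine ⟨fun hg r hr R C => minorsIdeal_le_rankStratum hr R C hg, fun hg => ?_⟩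
  obtain ⟨g', hgg', hred⟩ := exists_reduced_representative (diagWeight m t n)
    (minorsIdeal (r₀ + 1) (matY K m t n)) _ (exists_hasLead_mem_minorsIdeal K) g
  have hg' : ∀ r ≤ r₀, ∀ (R : Fin r ↪ Fin m) (C : Fin r ↪ Fin t), g' ∈ rankStratum K n R C := by
    intro r hr R C
    have := sub_mem (hg r hr R C) (minorsIdeal_le_rankStratum hr R C hgg')
    rwa [sub_sub_cancel] at this
  by_cases h0 : g' = 0
  · rwa [h0, sub_zero] at hgg'
  exfalso
  obtain ⟨e, he, hne⟩ := MvPolynomial.exists_forall_aeval_ne_zero (A := CoeffField K)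
    (genericWeight m t n) (linearIndependent_genericWeight m t n) h0
  obtain ⟨U, V, hUV⟩ := exists_rank_le_point _ (sum_X_pow_ne_zero K (r := r₀)) hm
    (fun c i => genericWeight m t n (Sum.inl (i, c)))
    (fun _ _ _ _ => genericWeight_monge_left) (cellsY e) (not_lt.1 (hred e he))
  -- The entries of `Z` are unconstrained here and take the prescribed valuations exactly.
  set x : (Fin m × Fin t) ⊕ (Fin t × Fin n) → HahnSeries (ValueGroup m t n) (CoeffField K) :=
    Sum.elim (fun v => (U * V) v.1 v.2)
      fun v => HahnSeries.single (genericWeight m t n (Sum.inr v)) 1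
  refine hne x ?_ (map_eq_zero_of_mem_rankStratum
    (MvPolynomial.aeval x : PolyYZ K m t n →ₐ[K] _).toRingHom U V ?_ hg')
  · rintro (v | v)
    · exact hUV v.1 v.2
    · have := addVal_single_one (A := CoeffField K) (genericWeight m t n (Sum.inr v))
      exact ⟨this.ge, fun _ => this⟩
  · exact aeval_map_matY x

end Decompositions

/-! ### Compatibility with the nullcone and the minors of `Y`. -/

section Compatibility

variable {K : Type u} [Field K] {m t n : ℕ} (p : ℕ) [Fact p.Prime] [CharP K p] (φ : K →+ K)

/-- An intersection of preserved ideals is preserved. -/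
theorem isCompatiblySplit_nullconeIdeal (hφ : ∀ a b, φ (a ^ p * b) = a * φ b) (hm : t ≤ m)
    (hn : t ≤ n) (hm0 : 0 < m) (hn0 : 0 < n) :
    IsCompatiblySplit (complexSplitting p φ hm hn) (nullconeIdeal K m t n) := by
  intro g hg
  rw [mem_nullconeIdeal_iff hm0 hn0] at hg ⊢
  exact fun r R C => isCompatiblySplit_nullconeGens p φ hφ hm hn R C g (hg r R C)

theorem isCompatiblySplit_minorsIdeal_matY (hφ : ∀ a b, φ (a ^ p * b) = a * φ b) (hm : t ≤ m)
    (hn : t ≤ n) (hm0 : 0 < m) (r : ℕ) :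
    IsCompatiblySplit (complexSplitting p φ hm hn) (minorsIdeal (r + 1) (matY K m t n)) := by
  intro g hg
  rw [mem_minorsIdeal_iff hm0] at hg ⊢
  exact fun r hr R C => isCompatiblySplit_rankGens p φ hφ hm hn R C g (hg r hr R C)

end Compatibility

/-! ### Transposition symmetry and the minors of `Z`. -/

section Swap

open MvPolynomial

variable {S : Type u} [CommRing S] {m t n : ℕ}

theorem diagMinorY_transpose (Z : Matrix (Fin t) (Fin n) S) (d : Fin n) :
    diagMinorY Z.transpose d = diagMinorZ Z d := by
  rw [diagMinorY, diagMinorZ, ← Matrix.det_transpose]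
  rfl

theorem diagMinorZ_transpose (Y : Matrix (Fin m) (Fin t) S) (d : Fin m) :
    diagMinorZ Y.transpose d = diagMinorY Y d := by
  rw [diagMinorY, diagMinorZ, ← Matrix.det_transpose]
  rfl

theorem det_mixedMatrix_transpose (Y : Matrix (Fin m) (Fin t) S) (Z : Matrix (Fin t) (Fin n) S)
    {a b k : ℕ} (i : Fin a → Fin m) (c : Fin a → Fin t) (d : Fin b → Fin t) (j : Fin b → Fin n)
    (e : Fin k → Fin t) :
    (mixedMatrix Z.transpose Y.transpose j d c i e).det = (mixedMatrix Y Z i c d j e).det := by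
  rw [← Matrix.det_transpose (mixedMatrix Y Z i c d j e),
    ← Matrix.det_submatrix_equiv_self ((Equiv.sumAssoc (Fin b) (Fin a) (Fin k)).symm.trans
      (((Equiv.sumComm (Fin b) (Fin a)).sumCongr (Equiv.refl (Fin k))).trans
        (Equiv.sumAssoc (Fin a) (Fin b) (Fin k))))]
  congr 1
  ext x y
  rcases x with x | x | x <;> rcases y with y | y | y <;>
    simp [mixedMatrix, Matrix.one_apply, eq_comm]

/-- The splitting polynomial is invariant under exchanging and transposing the matrices, which
carries results on `Y` over to `Z`. -/
theorem splittingPoly_transpose (hm : t ≤ m) (hn : t ≤ n) (Y : Matrix (Fin m) (Fin t) S)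
    (Z : Matrix (Fin t) (Fin n) S) :
    splittingPoly hn hm Z.transpose Y.transpose = splittingPoly hm hn Y Z := by
  simp only [splittingPoly, diagMinorY_transpose, diagMinorZ_transpose, productMinor,
    det_mixedMatrix_transpose]
  ring

theorem map_splittingPoly {S' : Type v} [CommRing S'] (ψ : S →+* S') (hm : t ≤ m) (hn : t ≤ n)
    (Y : Matrix (Fin m) (Fin t) S) (Z : Matrix (Fin t) (Fin n) S) :
    ψ (splittingPoly hm hn Y Z) = splittingPoly hm hn (Y.map ψ) (Z.map ψ) := by
  simp only [splittingPoly, map_mul, map_prod, diagMinorY, diagMinorZ, productMinor,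
    RingHom.map_det]
  have h : ∀ (k : Fin t), ψ.mapMatrix (mixedMatrix Y Z (Fin.castLE (k.2.le.trans hm))
      (fun l : Fin k => (⟨t - k + l, by omega⟩ : Fin t))
      (fun l : Fin k => (⟨t - k + l, by omega⟩ : Fin t)) (Fin.castLE (k.2.le.trans hn))
      (Fin.castLE (Nat.sub_le t k))) = mixedMatrix (Y.map ψ) (Z.map ψ)
      (Fin.castLE (k.2.le.trans hm)) (fun l : Fin k => (⟨t - k + l, by omega⟩ : Fin t))
      (fun l : Fin k => (⟨t - k + l, by omega⟩ : Fin t)) (Fin.castLE (k.2.le.trans hn))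
      (Fin.castLE (Nat.sub_le t k)) := by
    intro k
    rw [mixedMatrix, mixedMatrix, RingHom.mapMatrix_apply, ← Matrix.submatrix_map,
      Matrix.fromBlocks_map, Matrix.map_zero _ (map_zero ψ),
      Matrix.map_one _ (map_zero ψ) (map_one ψ)]
  simp only [h]
  rfl

variable {K : Type u} [Field K]

theorem rename_frobTrace {σ τ : Type*} [Fintype σ] [Fintype τ] (p : ℕ) [Fact p.Prime] (φ : K →+ K)
    (e : σ ≃ τ) (g : MvPolynomial σ K) :
    rename e (frobTrace p φ g) = frobTrace p φ (rename e g) := by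
  ext E
  obtain ⟨E, rfl⟩ : ∃ E', Finsupp.mapDomain e E' = E :=
    ⟨Finsupp.mapDomain e.symm E, by rw [← Finsupp.mapDomain_comp]; simp⟩
  have h : Finsupp.equivFunOnFinite.symm (fun _ : τ => p - 1) + p • Finsupp.mapDomain e E =
      Finsupp.mapDomain e (Finsupp.equivFunOnFinite.symm (fun _ : σ => p - 1) + p • E) := by
    ext v
    obtain ⟨v, rfl⟩ := e.surjective v
    rw [Finsupp.mapDomain_apply e.injective]
    simp [Finsupp.mapDomain_apply e.injective]
  rw [coeff_rename_mapDomain _ e.injective, coeff_frobTrace, coeff_frobTrace, h,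
    coeff_rename_mapDomain _ e.injective]

variable (m t n) in
/-- The bijection of the variables that exchanges the two matrices and transposes them. -/
def swapVars : (Fin m × Fin t) ⊕ (Fin t × Fin n) ≃ (Fin n × Fin t) ⊕ (Fin t × Fin m) :=
  (Equiv.sumComm _ _).trans ((Equiv.prodComm _ _).sumCongr (Equiv.prodComm _ _))

theorem map_rename_swapVars_matY :
    (matY K m t n).map (rename (R := K) (swapVars m t n)) = (matZ K n t m).transpose := by
  ext1 i c
  simp [matY, matZ, swapVars]

theorem map_rename_swapVars_matZ :
    (matZ K m t n).map (rename (R := K) (swapVars m t n)) = (matY K n t m).transpose := by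
  ext1 i c
  simp [matY, matZ, swapVars]

theorem rename_swapVars_swapVars (g : PolyYZ K m t n) :
    rename (swapVars n t m) (rename (swapVars m t n) g) = g := by
  have h : swapVars n t m ∘ swapVars m t n = id := by
    funext v
    rcases v with v | v <;> rfl
  rw [rename_rename, h, rename_id_apply]

theorem rename_complexSplitting (p : ℕ) [Fact p.Prime] (φ : K →+ K) (hm : t ≤ m) (hn : t ≤ n)
    (g : PolyYZ K m t n) :
    rename (swapVars m t n) (complexSplitting p φ hm hn g) =
      complexSplitting p φ hn hm (rename (swapVars m t n) g) := by
  have h := map_splittingPoly (rename (R := K) (swapVars m t n)).toRingHom hm hn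
    (matY K m t n) (matZ K m t n)
  have h' : rename (swapVars m t n) (splittingPoly hm hn (matY K m t n) (matZ K m t n)) =
      splittingPoly hn hm (matY K n t m) (matZ K n t m) := by
    refine h.trans (Eq.trans ?_ (splittingPoly_transpose hn hm (matY K n t m) (matZ K n t m)))
    exact congrArg₂ _ map_rename_swapVars_matY map_rename_swapVars_matZ
  simp only [complexSplitting, AddMonoidHom.comp_apply, AddMonoidHom.coe_mulLeft]
  rw [rename_frobTrace, map_mul, map_pow, h']

theorem map_mem_minorsIdeal {S' : Type v} [CommRing S'] (ψ : S →+* S') {a b k : ℕ}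
    {A : Matrix (Fin a) (Fin b) S} {g : S} (hg : g ∈ minorsIdeal k A) :
    ψ g ∈ minorsIdeal k (A.map ψ) := by
  have hle : minorsIdeal k A ≤ (minorsIdeal k (A.map ψ)).comap ψ := by
    rw [minorsIdeal, Ideal.span_le]
    rintro _ ⟨f, g, rfl⟩
    refine Ideal.subset_span ⟨f, g, ?_⟩
    rw [RingHom.map_det]
    rfl
  exact hle hg

theorem minorsIdeal_transpose {a b k : ℕ} (A : Matrix (Fin a) (Fin b) S) :
    minorsIdeal k A.transpose = minorsIdeal k A := by
  have key : ∀ {a b : ℕ} (A : Matrix (Fin a) (Fin b) S),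
      minorsIdeal k A.transpose ≤ minorsIdeal k A := by
    intro a b A
    rw [minorsIdeal, Ideal.span_le]
    rintro _ ⟨f, g, rfl⟩
    refine Ideal.subset_span ⟨g, f, ?_⟩
    rw [← Matrix.det_transpose]
    rfl
  exact le_antisymm (key A) (key A.transpose)

theorem isCompatiblySplit_minorsIdeal_matZ (p : ℕ) [Fact p.Prime] [CharP K p] (φ : K →+ K)
    (hφ : ∀ a b, φ (a ^ p * b) = a * φ b) (hm : t ≤ m) (hn : t ≤ n) (hn0 : 0 < n) (s : ℕ) :
    IsCompatiblySplit (complexSplitting p φ hm hn) (minorsIdeal (s + 1) (matZ K m t n)) := by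
  intro g hg
  have h1 := map_mem_minorsIdeal (rename (R := K) (swapVars m t n)).toRingHom hg
  have h2 : rename (swapVars m t n) g ∈ minorsIdeal (s + 1) (matY K n t m) := by
    rw [← minorsIdeal_transpose, ← map_rename_swapVars_matZ]
    exact h1
  have h3 := isCompatiblySplit_minorsIdeal_matY p φ hφ hn hm hn0 s _ h2
  rw [← rename_complexSplitting] at h3
  have h4 := map_mem_minorsIdeal (rename (R := K) (swapVars n t m)).toRingHom h3
  rw [← minorsIdeal_transpose, ← rename_swapVars_swapVars (complexSplitting p φ hm hn g),
    ← map_rename_swapVars_matY]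
  exact h4

theorem isCompatiblySplit_complexIdeal (p : ℕ) [Fact p.Prime] [CharP K p] (φ : K →+ K)
    (hφ : ∀ a b, φ (a ^ p * b) = a * φ b) (hm : t ≤ m) (hn : t ≤ n) (hm0 : 0 < m) (hn0 : 0 < n)
    (r s : ℕ) :
    IsCompatiblySplit (complexSplitting p φ hm hn) (complexIdeal K m t n r s) :=
  isCompatiblySplit_sup (isCompatiblySplit_sup
    (isCompatiblySplit_minorsIdeal_matY p φ hφ hm hn hm0 r)
    (isCompatiblySplit_minorsIdeal_matZ p φ hφ hm hn hn0 s))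
    (isCompatiblySplit_nullconeIdeal p φ hφ hm hn hm0 hn0)

end Swap

/-! ### From splittings to purity. -/

section Purity

/-- An `A`-linear left inverse remains a left inverse after tensoring with any module. -/
theorem ringHomIsPure_of_leftInverse {A : Type u} {B : Type v} [CommRing A] [CommRing B]
    (f : A →+* B) (θ : B →+ A) (hθ : ∀ a b, θ (f a * b) = a * θ b) (hθf : ∀ a, θ (f a) = a) :
    RingHomIsPure.{u, v, w} f := by
  let : Algebra A B := f.toAlgebra
  intro M _ _
  let ρ : B →ₗ[A] A :=
    { toFun := θ
      map_add' := map_add θ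
      map_smul' := fun a b => by rw [Algebra.smul_def]; exact hθ a b }
  have hρ : ρ ∘ₗ Algebra.linearMap A B = LinearMap.id := LinearMap.ext hθf
  refine Function.LeftInverse.injective (g := ρ.rTensor M) fun x => ?_
  rw [← LinearMap.comp_apply, ← LinearMap.rTensor_comp, hρ, LinearMap.rTensor_id,
    LinearMap.id_apply]

theorem IsFrobeniusSplitting.isFPure_quotient {S : Type u} [CommRing S] (p : ℕ) [ExpChar S p]
    (I : Ideal S) [ExpChar (S ⧸ I) p] (θ : S →+ S) (hθ : IsFrobeniusSplitting p θ)
    (hI : IsCompatiblySplit θ I) : IsFPure.{u, w} p (S ⧸ I) := by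
  let θ' : S ⧸ I →+ S ⧸ I := QuotientAddGroup.map I.toAddSubgroup I.toAddSubgroup θ hI
  have hθ' : ∀ a, θ' (Ideal.Quotient.mk I a) = Ideal.Quotient.mk I (θ a) := fun a => rfl
  refine ringHomIsPure_of_leftInverse _ θ' (fun a b => ?_) fun a => ?_
  · obtain ⟨a, rfl⟩ := Ideal.Quotient.mk_surjective a
    obtain ⟨b, rfl⟩ := Ideal.Quotient.mk_surjective b
    rw [frobenius_def, ← map_pow, ← map_mul, hθ', hθ', ← map_mul, ← hθ.map_frobenius_mul,
      frobenius_def]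
  · obtain ⟨a, rfl⟩ := Ideal.Quotient.mk_surjective a
    rw [frobenius_def, ← map_pow, hθ', ← frobenius_def, hθ.map_frobenius]

end Purity

/-! ### Reduction to large matrices. -/

section Retraction

open MvPolynomial

variable {K : Type u} [Field K] {m m' t n n' : ℕ}

/-- The inclusion of the variables of smaller matrices. -/
noncomputable def enlarge (K : Type u) [Field K] (t : ℕ) (hm : m ≤ m') (hn : n ≤ n') :
    PolyYZ K m t n →ₐ[K] PolyYZ K m' t n' :=
  rename (Sum.map (Prod.map (Fin.castLE hm) id) (Prod.map id (Fin.castLE hn)))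

/-- The map that annihilates the last rows of the first and the last columns of the second
matrix. -/
noncomputable def truncate (K : Type u) [Field K] (m m' t n n' : ℕ) :
    PolyYZ K m' t n' →ₐ[K] PolyYZ K m t n :=
  aeval (Sum.elim
    (fun v => if h : (v.1 : ℕ) < m then X (Sum.inl (⟨v.1, h⟩, v.2)) else 0)
    (fun v => if h : (v.2 : ℕ) < n then X (Sum.inr (v.1, ⟨v.2, h⟩)) else 0))

theorem truncate_enlarge (hm : m ≤ m') (hn : n ≤ n') (g : PolyYZ K m t n) :
    truncate K m m' t n n' (enlarge K t hm hn g) = g := by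
  suffices h : (truncate K m m' t n n').comp (enlarge K t hm hn) = AlgHom.id K _ from
    DFunLike.congr_fun h g
  ext (v | v) <;> simp [truncate, enlarge]

theorem enlarge_mem_nullconeIdeal (hm : m ≤ m') (hn : n ≤ n') {g : PolyYZ K m t n}
    (hg : g ∈ nullconeIdeal K m t n) : enlarge K t hm hn g ∈ nullconeIdeal K m' t n' := by
  have hle : nullconeIdeal K m t n ≤ (nullconeIdeal K m' t n').comap (enlarge K t hm hn) := by
    rw [nullconeIdeal, entriesIdeal, Ideal.span_le]
    rintro _ ⟨i, j, rfl⟩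
    refine Ideal.subset_span ⟨Fin.castLE hm i, Fin.castLE hn j, ?_⟩
    simp [Matrix.mul_apply, matY, matZ, enlarge]
  exact hle hg

theorem truncate_mem_nullconeIdeal {g : PolyYZ K m' t n'} (hg : g ∈ nullconeIdeal K m' t n') :
    truncate K m m' t n n' g ∈ nullconeIdeal K m t n := by
  have hle : nullconeIdeal K m' t n' ≤ (nullconeIdeal K m t n).comap (truncate K m m' t n n') := by
    rw [nullconeIdeal, entriesIdeal, Ideal.span_le]
    rintro _ ⟨i, j, rfl⟩
    rw [SetLike.mem_coe, Ideal.mem_comap]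
    by_cases hi : (i : ℕ) < m
    · by_cases hj : (j : ℕ) < n
      · refine Ideal.subset_span ⟨⟨i, hi⟩, ⟨j, hj⟩, ?_⟩
        simp [Matrix.mul_apply, matY, matZ, truncate, hi, hj]
      · simp [Matrix.mul_apply, matY, matZ, truncate, hj]
    · simp [Matrix.mul_apply, matY, matZ, truncate, hi]
  exact hle hg

variable (p : ℕ) [ExpChar K p]

/-- Enlarging and then truncating is the identity, and both maps respect the nullcone ideals. So
`truncate ∘ θ ∘ enlarge` is a compatible splitting for the smaller matrices. -/
theorem isFPure_genericNullcone_of_le (hm : m ≤ m') (hn : n ≤ n')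
    (θ : PolyYZ K m' t n' →+ PolyYZ K m' t n') (hθ : IsFrobeniusSplitting p θ)
    (hI : IsCompatiblySplit θ (nullconeIdeal K m' t n')) :
    IsFPure.{u, w} p (GenericNullcone K m t n) := by
  refine IsFrobeniusSplitting.isFPure_quotient p _
    (((truncate K m m' t n n' : _ →+* _).toAddMonoidHom.comp θ).comp
      (enlarge K t hm hn : _ →+* _).toAddMonoidHom) ⟨fun a b => ?_, fun a => ?_⟩ fun g hg => ?_
  · change truncate K m m' t n n' (θ (enlarge K t hm hn _)) =
      a * truncate K m m' t n n' (θ (enlarge K t hm hn b))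
    rw [frobenius_def, map_mul, map_pow, ← frobenius_def, hθ.map_frobenius_mul, map_mul,
      truncate_enlarge]
  · change truncate K m m' t n n' (θ (enlarge K t hm hn _)) = a
    rw [frobenius_def, map_pow, ← frobenius_def, hθ.map_frobenius, truncate_enlarge]
  · exact truncate_mem_nullconeIdeal (hI _ (enlarge_mem_nullconeIdeal hm hn hg))

end Retraction

/-! ### The main theorem. -/

theorem mainTheorem5 {K : Type u} [Field K] (p : ℕ) [Fact p.Prime] [CharP K p]
    (hK : IsFFinite p K) (m t n : ℕ) (hm : 0 < m) (ht : 0 < t) (hn : 0 < n) :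
    (t ≤ min m n →
      ∃ θ : PolyYZ K m t n →+ PolyYZ K m t n, IsFrobeniusSplitting p θ ∧
        ∀ r s : ℕ, r + s ≤ t → IsCompatiblySplit θ (complexIdeal K m t n r s)) ∧
    IsFPure.{u, w} p (GenericNullcone K m t n) := by
  obtain ⟨φ, hφ1, hφ⟩ := exists_frobenius_inverse_linear K p
  constructor
  · intro h
    obtain ⟨htm, htn⟩ := le_min_iff.1 h
    exact ⟨complexSplitting p φ htm htn, isFrobeniusSplitting_complexSplitting p φ hφ1 hφ htm htn,
      fun r s _ => isCompatiblySplit_complexIdeal p φ hφ htm htn hm hn r s⟩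
  -- Padding to `max m t` rows of `Y` and `max n t` columns of `Z` puts the sizes in the range where
  -- the splitting exists.
  · have htm : t ≤ max m t := le_max_right m t
    have htn : t ≤ max n t := le_max_right n t
    exact isFPure_genericNullcone_of_le p (le_max_left m t) (le_max_left n t)
      (complexSplitting p φ htm htn) (isFrobeniusSplitting_complexSplitting p φ hφ1 hφ htm htn)
      (isCompatiblySplit_nullconeIdeal p φ hφ htm htn (lt_max_of_lt_left hm)
        (lt_max_of_lt_left hn))
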